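/- **Setting.** Let $(\Omega,\mathcal F,\mathbb P)$ be a complete probability space, $T\in(0,\infty)$, $N\ge 2$ and $k,d\in\mathbb N$. Let $L:\Omega\times[0,T]\to\mathbb R^k$ be a càdlàg process and, for $i=1,\dots,N$, let $f^i:\Omega\times[0,T]\to\mathbb R_+^d$ be a continuous process (for instance a continuous semimartingale). Let $\bar{\mathbb F}_+^{f,L}$ be the right-continuous extension of the filtration generated by $f=(f^1,\dots,f^N)$ and $L$, augmented by the $\mathbb P$-null sets. Let $\mathcal A$ be the set of $\bar{\mathbb F}_+^{f,L}$-adapted càdlàg processes $V:\Omega\times[0,T]\to\mathbb R^d$ with nondecreasing and nonnegative components. For each $i$ let $h^i,g^i:\mathbb R^k\times\mathbb R^{Nd}\to[0,\infty)$ be measurable. For $\mathbf A=(A^i,A^{-i})\in\mathcal A^N$ put $$\mathcal J^i(A^i,A^{-i})=\mathbb E\Big[\int_0^T h^i(L_t,\mathbf A_t)\,dt+g^i(L_T,\mathbf A_T)+\int_{[0,T]}f^i_t\,dA^i_t\Big]\in[0,\infty],$$ where $\int_{[0,T]}f^i_t\,dA^i_t=\sum_{\ell=1}^d\big(f_0^{\ell,i}A_0^{\ell,i}+\int_{(0,T]}f_t^{\ell,i}\,dA_t^{\ell,i}\big)$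 in the Lebesgue–Stieltjes sense. A profile $\bar{\mathbf A}\in\mathcal A^N$ is a *Nash equilibrium* if for every $i$ one has $\mathcal J^i(\bar{\mathbf A})<\infty$ and $\mathcal J^i(\bar A^i,\bar A^{-i})\le\mathcal J^i(V^i,\bar A^{-i})$ for all $V^i\in\mathcal A$. Write $\mathbf A\preccurlyeq^N\mathbf B$ if, for every $i$, $\mathbb P$-a.s. $A^i_t\le B^i_t$ for all $t\in[0,T]$; processes that are indistinguishable are identified. Vectors are ordered componentwise, $\wedge,\vee$ are the componentwise minimum and maximum, and $|\cdot|$ is the Euclidean norm. **Theorem.** Assume that for each $i$ and each $\phi^i\in\{h^i,g^i\}$: 1. for each $(l,a^{-i})$, $\phi^i(l,\cdot,a^{-i})$ is lower semicontinuous and strictly convex on $\mathbb R^d$; 2. for each $l$ and all $a,\bar a\in\mathbb R^{Nd}$ with $\bar a\ge a$, $\ \phi^i(l,\bar a^i,a^{-i})-\phi^i(l,a^i,a^{-i})\ge\phi^i(l,\bar a^i,\bar a^{-i})-\phi^i(l,a^i,\bar a^{-i})$; 3. for each $(l,a^{-i})$ and all $a^i,\bar a^i\in\mathbb R^d$, $\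 \phi^i(l,\bar a^i,a^{-i})+\phi^i(l,a^i,a^{-i})\ge\phi^i(l,\bar a^i\wedge a^i,a^{-i})+\phi^i(l,\bar a^i\vee a^i,a^{-i})$. Assume there are constants $K,\kappa>0$ such that for each $i$ $$\mathcal J^i(A^i,A^{-i})\ge\kappa\,\mathbb E[|A^i_T|]\quad\text{for all }\mathbf A\in\mathcal A^N\text{ with }\mathbb E[|A^i_T|]\ge K,$$ and a constant $M>0$ such that for each $i$ and every $\mathbf A\in\mathcal A^N$ there is $r^i(\mathbf A)\in\mathcal A$ with $\mathcal J^i(r^i(\mathbf A),A^{-i})\le M$. Then the set $F\subset\mathcal A^N$ of Nash equilibria is nonempty, and the partially ordered set $(F,\preccurlyeq^N)$ is a complete lattice: every subset of $F$ has a least upper bound and a greatest lower bound in $F$. -/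

import Mathlib

open MeasureTheory Set Filter Topology

/-- Right-continuous with left limits. -/
def IsCadlagPath {ι E : Type*} [Preorder ι] [TopologicalSpace ι] [TopologicalSpace E]
    (x : ι → E) : Prop :=
  ∀ t, ContinuousWithinAt x (Ici t) t ∧ ∃ l, Tendsto x (𝓝[<] t) (𝓝 l)

/-- The data of an `N`-player monotone-follower game on `Ω`, with horizon `T`, strategies in `ℝᵈ`
and environment `L` in `ℝᵏ`: player `i` has the price process `f i` (continuous, with nonnegative
components), the running cost `h i` and the terminal cost `g i`, both functions of
`(l, a) ∈ ℝᵏ × (ℝᵈ)ᴺ`. Real vectors carry the componentwise order. -/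
structure MonotoneFollowerGame (Ω : Type*) [MeasurableSpace Ω] (N k d : ℕ) where
  T : ℝ
  T_pos : 0 < T
  L : Icc (0 : ℝ) T → Ω → (Fin k → ℝ)
  measurable_L : ∀ t, Measurable (L t)
  cadlag_L : ∀ ω, IsCadlagPath fun t => L t ω
  f : Fin N → Icc (0 : ℝ) T → Ω → (Fin d → ℝ)
  measurable_f : ∀ i t, Measurable (f i t)
  continuous_f : ∀ i ω, Continuous fun t => f i t ω
  f_nonneg : ∀ i t ω, 0 ≤ f i t ω
  h : Fin N → (Fin k → ℝ) → (Fin N → Fin d → ℝ) → ℝ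
  measurable_h : ∀ i, Measurable fun p : (Fin k → ℝ) × (Fin N → Fin d → ℝ) => h i p.1 p.2
  h_nonneg : ∀ i l a, 0 ≤ h i l a
  g : Fin N → (Fin k → ℝ) → (Fin N → Fin d → ℝ) → ℝ
  measurable_g : ∀ i, Measurable fun p : (Fin k → ℝ) × (Fin N → Fin d → ℝ) => g i p.1 p.2
  g_nonneg : ∀ i l a, 0 ≤ g i l a

/-- Structural conditions on a cost function `φ` of player `i`. Here `Function.update a i x` is
the profile `(x, a⁻ⁱ)`. -/
structure IsSubmodularCost {N k d : ℕ} (i : Fin N)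
    (φ : (Fin k → ℝ) → (Fin N → Fin d → ℝ) → ℝ) : Prop where
  lowerSemicontinuous : ∀ l a, LowerSemicontinuous fun x => φ l (Function.update a i x)
  strictConvex : ∀ l a, StrictConvexOn ℝ univ fun x => φ l (Function.update a i x)
  decreasingDifferences : ∀ l a b, a ≤ b →
    φ l b - φ l (Function.update b i (a i)) ≤ φ l (Function.update a i (b i)) - φ l a
  submodular : ∀ l a x y,
    φ l (Function.update a i (x ⊓ y)) + φ l (Function.update a i (x ⊔ y)) ≤
      φ l (Function.update a i x) + φ l (Function.update a i y)

/-- Adjoin the `P`-null sets to every σ-algebra of a filtration. -/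
def augmentNull {Ω ι : Type*} [Preorder ι] {m : MeasurableSpace Ω} (P : Measure Ω) [P.IsComplete]
    (F : Filtration ι m) : Filtration ι m where
  seq t := F t ⊔ MeasurableSpace.generateFrom {s | P s = 0}
  mono' _ _ hst := sup_le_sup_right (F.mono hst) _
  le' t := sup_le (F.le t)
    (MeasurableSpace.generateFrom_le fun _ hs => Measure.IsComplete.out' _ hs)

namespace MonotoneFollowerGame

variable {Ω : Type*} [MeasurableSpace Ω] {N k d : ℕ}

/-- The initial time, as a point of `[0, T]`. -/
def tZero (G : MonotoneFollowerGame Ω N k d) : Icc (0 : ℝ) G.T := ⟨0, le_rfl, G.T_pos.le⟩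

/-- The terminal time, as a point of `[0, T]`. -/
def tEnd (G : MonotoneFollowerGame Ω N k d) : Icc (0 : ℝ) G.T := ⟨G.T, G.T_pos.le, le_rfl⟩

/-- The clock: a real time, clamped to `[0, T]`. It is the identity on `[0, T]`. -/
noncomputable def clock (G : MonotoneFollowerGame Ω N k d) (t : ℝ) : Icc (0 : ℝ) G.T :=
  projIcc 0 G.T G.T_pos.le t

/-- The filtration generated by `f = (f¹, …, fᴺ)` and `L`. -/
noncomputable def rawFiltration (G : MonotoneFollowerGame Ω N k d) :
    Filtration (Icc (0 : ℝ) G.T) ‹MeasurableSpace Ω› :=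
  Filtration.natural (fun t ω => ((fun i => G.f i t ω), G.L t ω)) fun t =>
    ((measurable_pi_lambda _ fun i => G.measurable_f i t).prodMk
      (G.measurable_L t)).stronglyMeasurable

/-- The filtration of the game: the one generated by `f` and `L`, augmented by the `P`-null sets
and made right-continuous. -/
noncomputable def filtration (G : MonotoneFollowerGame Ω N k d) (P : Measure Ω) [P.IsComplete] :
    Filtration (Icc (0 : ℝ) G.T) ‹MeasurableSpace Ω› :=
  (augmentNull P G.rawFiltration).rightCont

/-- Admissible strategies: adapted càdlàg processes with nondecreasing, nonnegative components. -/
structure Strategy (G : MonotoneFollowerGame Ω N k d) (P : Measure Ω) [P.IsComplete] where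
  val : Icc (0 : ℝ) G.T → Ω → (Fin d → ℝ)
  adapted : Adapted (G.filtration P) val
  cadlag : ∀ ω, IsCadlagPath fun t => val t ω
  mono : ∀ ω, Monotone fun t => val t ω
  nonneg : ∀ t ω, 0 ≤ val t ω

variable {G : MonotoneFollowerGame Ω N k d} {P : Measure Ω} [P.IsComplete]

/-- `A ≤ B` means that almost surely `A t ≤ B t` for all `t ∈ [0, T]`. It is a preorder, whose
equivalence is indistinguishability. Strategy profiles `Fin N → G.Strategy P` carry the
playerwise order. -/
instance : Preorder (G.Strategy P) where
  le A B := ∀ᵐ ω ∂P, ∀ t, A.val t ω ≤ B.val t ω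
  le_refl _ := Eventually.of_forall fun _ _ => le_rfl
  le_trans _ _ _ h₁ h₂ := by
    filter_upwards [h₁, h₂] with ω h₁ h₂ t using (h₁ t).trans (h₂ t)

/-- The path of the `l`-th component of a strategy, extended to `ℝ` by its values at `0` and `T`,
as a right-continuous nondecreasing function. -/
noncomputable def Strategy.stieltjes (A : G.Strategy P) (ω : Ω) (l : Fin d) :
    StieltjesFunction ℝ where
  toFun := IccExtend G.T_pos.le fun t => A.val t ω l
  mono' := Monotone.IccExtend (h := G.T_pos.le) fun _ _ hst => A.mono ω hst l
  right_continuous' x := by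
    have h := continuousWithinAt_pi.1 (A.cadlag ω (projIcc 0 G.T G.T_pos.le x)).1 l
    exact h.comp (t := Ici (projIcc 0 G.T G.T_pos.le x))
      (continuous_projIcc.continuousWithinAt) fun y hy => monotone_projIcc G.T_pos.le hy

/-- `∫_{[0,T]} fⁱ dA := ∑ₗ f₀ˡ A₀ˡ + ∑ₗ ∫_{(0,T]} fˡ dAˡ`, along the path `ω`. All terms are
nonnegative. -/
noncomputable def Strategy.controlCost (A : G.Strategy P) (i : Fin N) (ω : Ω) : ENNReal :=
  ∑ l, (ENNReal.ofReal (G.f i G.tZero ω l * A.val G.tZero ω l) +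
    ∫⁻ t in Ioc 0 G.T, ENNReal.ofReal (G.f i (G.clock t) ω l)
      ∂(A.stieltjes ω l).measure)

/-- `E[|A_T|]`, with the Euclidean norm. -/
noncomputable def Strategy.expectedTerminalNorm (A : G.Strategy P) : ENNReal :=
  ∫⁻ ω, ‖WithLp.toLp 2 (A.val G.tEnd ω)‖ₑ ∂P

/-- The cost functional of player `i`,
`E[∫₀ᵀ hⁱ(Lₜ, Aₜ) dt + gⁱ(L_T, A_T) + ∫_{[0,T]} fⁱ dAⁱ] ∈ [0, ∞]`. -/
noncomputable def cost (i : Fin N) (A : Fin N → G.Strategy P) : ENNReal :=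
  ∫⁻ ω, ((∫⁻ t in Icc 0 G.T,
      ENNReal.ofReal (G.h i (G.L (G.clock t) ω) fun j => (A j).val (G.clock t) ω)) +
    ENNReal.ofReal (G.g i (G.L G.tEnd ω) fun j => (A j).val G.tEnd ω) +
    (A i).controlCost i ω) ∂P

variable (G P) in
/-- The set of Nash equilibria: every player has finite cost and no profitable deviation. -/
def nashEquilibria : Set (Fin N → G.Strategy P) :=
  {A | ∀ i, cost i A < ⊤ ∧ ∀ V : G.Strategy P, cost i A ≤ cost i (Function.update A i V)}

end MonotoneFollowerGame

/-! Submodularity and decreasing differences make best replies nondecreasing in the opponents'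
strategies; strict convexity makes them unique up to indistinguishability. Equilibria are therefore
the fixed points, up to equivalence, of a monotone map `R`, and the theorem is a variant of Tarski's
(`fixedPoints_complete`). Two ingredients of Tarski's theorem are not immediate: arbitrary infima of
processes cannot be taken pathwise, and no greatest strategy is available.

Countable infima are pathwise, and the bounded, strictly increasing functional `arctanEnergy`
reduces arbitrary infima to countable ones (`exists_isGLB_profile`). The top element is replaced by
the greatest subsolution `A ≤ R A` (`exists_isGreatest_le_apply`). Every subsolution lies below a
best reply, whose expected terminal norm is bounded through coercivity and `M`; hence increasing
sequences of subsolutions have limits, the Brezis–Browder principle gives a maximal subsolution, and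
joins show that it is the greatest.

Best replies exist without any compactness argument (`exists_forall_le_of_submodular`). For
near-minimizers with summable errors, submodularity keeps finite joins near-minimal, so an upper
limit, formed by one increasing and one decreasing limit, is a minimizer. The lower semicontinuity
needed is Fatou's lemma together with a portmanteau argument for the control cost. Convergence means
convergence almost everywhere for `timeMeasure`: this covers both running and terminal costs, and it
survives the right-continuous regularization of a supremum. -/

/-! ### Order theory: maximal elements, infima and fixed points. -/

/-- The Brezis–Browder principle: a set in which every increasing sequence is bounded has a
maximal element, provided that the order carries a bounded, strictly increasing functional. -/
theorem exists_maximal_of_monotone_functional {α : Type*} [Preorder α] (Φ : α → ℝ)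
    (hΦ : Monotone Φ) (hb : BddAbove (range Φ)) (hs : ∀ a b, a ≤ b → Φ b ≤ Φ a → b ≤ a)
    {S : Set α} (hne : S.Nonempty)
    (hseq : ∀ u : ℕ → α, Monotone u → (∀ n, u n ∈ S) → ∃ b ∈ S, ∀ n, u n ≤ b) :
    ∃ a, Maximal (· ∈ S) a := by
  -- Choosing `Φ b` above the midpoint of `Φ a` and the supremum over points above `a` leaves a
  -- remaining gain no larger than the gain just made.
  have step : ∀ a : S, ∃ b : S, a ≤ b ∧ ∀ c ∈ S, (a : α) ≤ c → Φ c - Φ b ≤ Φ b - Φ a := by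
    intro a
    set s := sSup (Φ '' {c | c ∈ S ∧ (a : α) ≤ c})
    have hbd : BddAbove (Φ '' {c | c ∈ S ∧ (a : α) ≤ c}) := hb.mono (image_subset_range _ _)
    have has : Φ a ≤ s := le_csSup hbd ⟨a, ⟨a.2, le_rfl⟩, rfl⟩
    have hle : ∀ c ∈ S, (a : α) ≤ c → Φ c ≤ s := fun c hc hac => le_csSup hbd ⟨c, ⟨hc, hac⟩, rfl⟩
    rcases has.eq_or_lt with h | h
    · exact ⟨a, le_rfl, fun c hc hac => by linarith [hle c hc hac]⟩
    · obtain ⟨_, ⟨b, ⟨hbS, hab⟩, rfl⟩, hb'⟩ :=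
        exists_lt_of_lt_csSup (s := Φ '' {c | c ∈ S ∧ (a : α) ≤ c})
          ⟨_, ⟨(a : α), ⟨a.2, le_rfl⟩, rfl⟩⟩
          (show (Φ a + s) / 2 < s by linarith)
      exact ⟨⟨b, hbS⟩, hab, fun c hc hac => by linarith [hle c hc hac]⟩
  choose next hnext hgap using step
  obtain ⟨a₀, ha₀⟩ := hne
  let u : ℕ → S := fun n => next^[n] ⟨a₀, ha₀⟩
  have hsucc : ∀ n, u (n + 1) = next (u n) := fun n => Function.iterate_succ_apply' next n _
  have hu : Monotone u := monotone_nat_of_le_succ fun n => (hsucc n).symm ▸ hnext (u n)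
  obtain ⟨b, hbS, hub⟩ := hseq (Subtype.val ∘ u) (fun _ _ h => hu h) fun n => (u n).prop
  refine ⟨b, hbS, fun c hc hbc => hs _ _ hbc ?_⟩
  -- The gains along `u` tend to zero, and they control the remaining gain, so no point of `S` above
  -- `b` has a larger value of `Φ`.
  have hmono : Monotone fun n => Φ (u n) := fun m n h => hΦ (hu h)
  have hlim := tendsto_atTop_ciSup hmono (hb.mono (range_comp_subset_range (fun n => (u n : α)) Φ))
  have hlim' := (hlim.comp (tendsto_add_atTop_nat 1))
  have h1 : Tendsto (fun n => Φ (u (n + 1)) + (Φ (u (n + 1)) - Φ (u n))) atTop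
      (𝓝 ((⨆ n, Φ (u n)) + ((⨆ n, Φ (u n)) - ⨆ n, Φ (u n)))) := hlim'.add (hlim'.sub hlim)
  have h2 : Φ c ≤ ⨆ n, Φ (u n) := by
    have hc' : ∀ n, Φ c ≤ Φ (u (n + 1)) + (Φ (u (n + 1)) - Φ (u n)) := fun n => by
      have hn : Φ c - Φ (u (n + 1)) ≤ Φ (u (n + 1)) - Φ (u n) :=
        hsucc n ▸ hgap (u n) c hc ((hub n).trans hbc)
      linarith
    simpa using ge_of_tendsto' h1 hc'
  exact h2.trans (ciSup_le fun n => hΦ (hub n))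

/-- Existence of countable infima together with a bounded strictly increasing functional implies
the existence of all nonempty infima. -/
theorem exists_isGLB_of_monotone_functional {α : Type*} [Preorder α] (Φ : α → ℝ)
    (hΦ : Monotone Φ) (hb : BddBelow (range Φ)) (hs : ∀ a b, a ≤ b → Φ b ≤ Φ a → b ≤ a)
    (hinf : ∀ u : ℕ → α, ∃ a, IsGLB (range u) a) {D : Set α} (hD : D.Nonempty) :
    ∃ a, IsGLB D a := by
  -- A minimal element among infima of countable subfamilies is a lower bound of `D`: adjoining one
  -- more point of `D` cannot lower it.
  let S : Set α := {a | ∃ u : ℕ → α, (∀ n, u n ∈ D) ∧ IsGLB (range u) a}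
  obtain ⟨a, ⟨u, huD, hua⟩, hmin⟩ : ∃ a : αᵒᵈ, Maximal (· ∈ OrderDual.ofDual ⁻¹' S) a := by
    refine exists_maximal_of_monotone_functional (fun a : αᵒᵈ => -Φ (OrderDual.ofDual a))
      (fun a b h => neg_le_neg (hΦ h)) ?_ (fun a b h h' => hs _ _ h (neg_le_neg_iff.1 h')) ?_ ?_
    · obtain ⟨c, hc⟩ := hb
      exact ⟨-c, by rintro _ ⟨a, rfl⟩; exact neg_le_neg (hc ⟨_, rfl⟩)⟩
    · obtain ⟨x, hx⟩ := hD
      obtain ⟨a, ha⟩ := hinf fun _ => x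
      exact ⟨OrderDual.toDual a, _, fun _ => hx, ha⟩
    · intro v _ hvS
      choose w hwD hw using hvS
      -- Pairing merges countably many sequences into one, whose infimum is below all of theirs.
      obtain ⟨b, hb⟩ := hinf fun n => w n.unpair.1 n.unpair.2
      refine ⟨OrderDual.toDual b, ⟨_, fun n => hwD _ _, hb⟩, fun n => ?_⟩
      refine (hw n).2 ?_
      rintro _ ⟨m, rfl⟩
      have h : b ≤ w (Nat.pair n m).unpair.1 (Nat.pair n m).unpair.2 := hb.1 ⟨_, rfl⟩
      rwa [Nat.unpair_pair] at h
  refine ⟨OrderDual.ofDual a, fun x hx => ?_, fun y hy => hua.2 ?_⟩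
  · let v : ℕ → α := fun n => Nat.casesOn n x u
    obtain ⟨b, hb⟩ := hinf v
    have hba : b ≤ OrderDual.ofDual a := hua.2 (by rintro _ ⟨n, rfl⟩; exact hb.1 ⟨n + 1, rfl⟩)
    have hvD : ∀ n, v n ∈ D := by rintro (_ | n); exacts [hx, huD n]
    exact (show OrderDual.ofDual a ≤ b from hmin (y := OrderDual.toDual b) ⟨v, hvD, hb⟩ hba).trans
      (hb.1 ⟨0, rfl⟩)
  · rintro _ ⟨n, rfl⟩
    exact hy (huD n)

/-- If every set in a preorder has a least upper bound, then its antisymmetrization is a complete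
lattice. -/
theorem Antisymmetrization.exists_isLUB_isGLB {β : Type*} [Preorder β]
    (h : ∀ S : Set β, ∃ b, IsLUB S b) (S : Set (Antisymmetrization β (· ≤ ·))) :
    (∃ B, IsLUB S B) ∧ ∃ B, IsGLB S B := by
  have lub : ∀ S : Set (Antisymmetrization β (· ≤ ·)), ∃ B, IsLUB S B := by
    intro S
    obtain ⟨b, hb⟩ := h (toAntisymmetrization (· ≤ ·) ⁻¹' S)
    refine ⟨toAntisymmetrization _ b, fun x hx => ?_, fun x hx => ?_⟩
    · induction x using Quotient.inductionOn'
      exact hb.1 hx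
    · induction x using Quotient.inductionOn'
      exact hb.2 fun y hy => hx hy
  refine ⟨lub S, ?_⟩
  obtain ⟨B, hB⟩ := lub (lowerBounds S)
  exact ⟨B, isLUB_lowerBounds.1 hB⟩

/-- Tarski's fixed point theorem for a preorder with nonempty infima, in which the set of points
with `a ≤ R a` has a greatest element: the fixed points up to equivalence form a complete lattice. -/
theorem fixedPoints_complete {α : Type*} [Preorder α] {R : α → α} (hR : Monotone R)
    (hinf : ∀ D : Set α, D.Nonempty → ∃ a, IsGLB D a)
    {z : α} (hz : IsGreatest {a | a ≤ R a} z) {F : Set α}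
    (hF : ∀ a, a ∈ F ↔ a ≤ R a ∧ R a ≤ a) :
    F.Nonempty ∧ ∀ S : Set (Antisymmetrization F (· ≤ ·)),
      (∃ B, IsLUB S B) ∧ ∃ B, IsGLB S B := by
  have hzF : z ∈ F := (hF z).2 ⟨hz.1, hz.2 (hR hz.1)⟩
  refine ⟨⟨z, hzF⟩, Antisymmetrization.exists_isLUB_isGLB fun S => ?_⟩
  -- The supremum of `S` among fixed points is the least supersolution above `S`. The point `z`,
  -- which dominates every fixed point, shows that there is one.
  let U : Set α := {a | R a ≤ a ∧ ∀ b ∈ S, (b : α) ≤ a}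
  obtain ⟨w, hw⟩ := hinf U ⟨z, ((hF z).1 hzF).2, fun b _ => hz.2 ((hF b).1 b.2).1⟩
  have hSw : ∀ b ∈ S, (b : α) ≤ w := fun b hb => hw.2 fun a ha => ha.2 b hb
  have hRw : R w ≤ w := hw.2 fun a ha => (hR (hw.1 ha)).trans ha.1
  have hwR : w ≤ R w := hw.1 ⟨hR hRw, fun b hb => ((hF b).1 b.2).1.trans (hR (hSw b hb))⟩
  refine ⟨⟨w, (hF w).2 ⟨hwR, hRw⟩⟩, fun b hb => hSw b hb, fun c hc => ?_⟩
  exact hw.1 ⟨((hF c).1 c.2).2, fun b hb => hc hb⟩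

/-! ### Right-continuous paths and integration on the line. -/

/-- A right-continuous nondecreasing path on a compact interval is càdlàg. -/
theorem Monotone.isCadlagPath {a b : ℝ} {ι : Type*} {x : Icc a b → ι → ℝ} (hx : Monotone x)
    (hr : ∀ t, ContinuousWithinAt x (Ici t) t) : IsCadlagPath x := by
  refine fun t => ⟨hr t, ?_⟩
  refine ⟨fun i => sSup ((fun s => x s i) '' Iio t), tendsto_pi_nhds.2 fun i => ?_⟩
  exact Monotone.tendsto_nhdsLT (α := Icc a b) (β := ℝ) (f := fun s => x s i)
    (fun s s' h => hx h i) t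

/-- Rounding time up to the grid of mesh `1 / (n + 1)` leaves countably many time values, and right
continuity recovers the process in the limit. -/
theorem measurable_uncurry_of_continuousWithinAt_Ici {Ω E : Type*} [MeasurableSpace Ω]
    [TopologicalSpace E] [TopologicalSpace.PseudoMetrizableSpace E] [MeasurableSpace E]
    [BorelSpace E] {u : ℝ → Ω → E} (hm : ∀ t, Measurable (u t))
    (hr : ∀ ω t, ContinuousWithinAt (fun s => u s ω) (Ici t) t) :
    Measurable fun p : Ω × ℝ => u p.2 p.1 := by
  let τ : ℕ → ℝ → ℝ := fun n t => (⌊t * (n + 1)⌋ + 1 : ℤ) / ((n : ℝ) + 1)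
  have hn : ∀ n : ℕ, (0 : ℝ) < n + 1 := fun n => by positivity
  have hτ : ∀ t n, t ≤ τ n t := fun t n => by
    simp only [τ, le_div_iff₀ (hn n)]
    push_cast
    exact (Int.lt_floor_add_one _).le
  have hτ' : ∀ t n, τ n t ≤ t + 1 / ((n : ℝ) + 1) := fun t n => by
    simp only [τ, div_le_iff₀ (hn n), add_mul, div_mul_cancel₀ _ (hn n).ne']
    push_cast
    linarith [Int.floor_le (t * ((n : ℝ) + 1))]
  refine measurable_of_tendsto_metrizable (f := fun n (p : Ω × ℝ) => u (τ n p.2) p.1) ?_ ?_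
  · intro n
    have h1 : Measurable fun p : Ω × ℤ => u ((p.2 + 1 : ℤ) / ((n : ℝ) + 1)) p.1 :=
      measurable_from_prod_countable_left fun k => hm ((k + 1 : ℤ) / ((n : ℝ) + 1))
    exact h1.comp (measurable_fst.prodMk
      (Int.measurable_floor.comp (measurable_snd.mul_const ((n : ℝ) + 1))))
  · refine tendsto_pi_nhds.2 fun p => (hr p.1 p.2).tendsto.comp ?_
    refine tendsto_nhdsWithin_iff.2 ⟨?_, Eventually.of_forall fun n => hτ _ _⟩
    refine tendsto_of_tendsto_of_tendsto_of_le_of_le tendsto_const_nhds ?_ (hτ p.2) (hτ' p.2)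
    simpa using tendsto_one_div_add_atTop_nhds_zero_nat.const_add p.2

/-- An inequality between right-continuous paths on `[0, T]` that holds at almost every time and
at time `T` holds everywhere. -/
theorem forall_le_of_ae_le {E : Type*} [TopologicalSpace E] [Preorder E] [OrderClosedTopology E]
    {T : ℝ} {x y : ℝ → E} (hx : ∀ t, ContinuousWithinAt x (Ici t) t)
    (hy : ∀ t, ContinuousWithinAt y (Ici t) t)
    (h : ∀ᵐ t ∂volume.restrict (Icc 0 T), x t ≤ y t) (hT : x T ≤ y T)
    {t : ℝ} (ht : t ∈ Icc 0 T) : x t ≤ y t := by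
  rcases ht.2.eq_or_lt with rfl | htT
  · exact hT
  have hfreq : ∃ᶠ s in 𝓝[>] t, x s ≤ y s := by
    intro hcon
    obtain ⟨u, hu, hsub⟩ := (mem_nhdsGT_iff_exists_Ioo_subset' htT).1 hcon
    have h0 : volume (Ioo t (min u T)) = 0 := by
      rw [ae_restrict_iff' measurableSet_Icc] at h
      refine measure_mono_null (fun s hs => ?_) h
      have h1 : ¬ x s ≤ y s := hsub ⟨hs.1, hs.2.trans_le (min_le_left _ _)⟩
      exact fun hmem => h1 (hmem ⟨ht.1.trans hs.1.le, hs.2.le.trans (min_le_right _ _)⟩)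
    have : t < min u T := lt_min hu htT
    simp only [Real.volume_Ioo, ENNReal.ofReal_eq_zero] at h0
    linarith
  exact le_of_tendsto_of_tendsto_of_frequently ((hx t).mono Ioi_subset_Ici_self)
    ((hy t).mono Ioi_subset_Ici_self) hfreq

/-- If the distribution functions of finite measures on `ℝ` converge almost everywhere, integrals
of nonnegative continuous functions are lower semicontinuous. -/
theorem lintegral_le_liminf_of_tendsto_measure_Iic {μ : Measure ℝ} {μs : ℕ → Measure ℝ}
    [IsFiniteMeasure μ] [∀ n, IsFiniteMeasure (μs n)]
    (h : ∀ᵐ t ∂volume, Tendsto (fun n => μs n (Iic t)) atTop (𝓝 (μ (Iic t))))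
    {f : ℝ → ℝ} (hf : Continuous f) (hf0 : 0 ≤ f) :
    ∫⁻ x, ENNReal.ofReal (f x) ∂μ ≤
      liminf (fun n => ∫⁻ x, ENNReal.ofReal (f x) ∂(μs n)) atTop := by
  refine lintegral_le_liminf_lintegral_of_forall_isOpen_measure_le_liminf_measure hf hf0 ?_
  intro G hG
  set E : Set ℝ := {t | Tendsto (fun n => μs n (Iic t)) atTop (𝓝 (μ (Iic t)))} with hE
  have hdense : Dense E := Measure.dense_of_ae h
  -- Half-open intervals with endpoints of convergence form a π-system on which the masses converge.
  -- An open set is a countable union of them, and finite unions exhaust its mass.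
  set S : Set (Set ℝ) := {s | ∃ a ∈ E, ∃ b ∈ E, a < b ∧ Ioc a b = s} with hS
  have hSpi : IsPiSystem S := isPiSystem_Ioc_mem E E
  have hSmeas : ∀ s ∈ S, MeasurableSet s := by
    rintro _ ⟨a, -, b, -, -, rfl⟩
    exact measurableSet_Ioc
  have hIoc : ∀ (ρ : Measure ℝ) [IsFiniteMeasure ρ] (a b : ℝ), a < b →
      ρ.real (Ioc a b) = ρ.real (Iic b) - ρ.real (Iic a) := by
    intro ρ _ a b hab
    rw [← measureReal_sdiff (Iic_subset_Iic.2 hab.le) measurableSet_Iic, Iic_sdiff_Iic]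
  have hSlim : ∀ s ∈ S, Tendsto (fun n => (μs n).real s) atTop (𝓝 (μ.real s)) := by
    rintro _ ⟨a, ha, b, hb, hab, rfl⟩
    simp only [hIoc _ a b hab]
    exact ((ENNReal.tendsto_toReal (measure_ne_top _ _)).comp hb).sub
      ((ENNReal.tendsto_toReal (measure_ne_top _ _)).comp ha)
  have hnhds : ∀ x ∈ G, ∃ s ∈ S, s ∈ 𝓝 x ∧ s ⊆ G := by
    intro x hx
    obtain ⟨ε, hε, hball⟩ := Metric.isOpen_iff.1 hG x hx
    obtain ⟨a, ha, ha1, ha2⟩ := hdense.exists_between (show x - ε < x by linarith)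
    obtain ⟨b, hb, hb1, hb2⟩ := hdense.exists_between (show x < x + ε by linarith)
    refine ⟨Ioc a b, ⟨a, ha, b, hb, ha2.trans hb1, rfl⟩, Ioc_mem_nhds ha2 hb1, fun y hy => hball ?_⟩
    rw [Real.ball_eq_Ioo]
    exact ⟨ha1.trans hy.1, hy.2.trans_lt hb2⟩
  obtain ⟨C, hCS, hCc, hCG⟩ : ∃ C : Set (Set ℝ), C ⊆ S ∧ C.Countable ∧ ⋃₀ C = G := by
    choose! s hsS hsn hsG using hnhds
    obtain ⟨D, hDG, hDc, hD⟩ := TopologicalSpace.countable_cover_nhdsWithin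
      (f := s) fun x hx => mem_nhdsWithin_of_mem_nhds (hsn x hx)
    refine ⟨s '' D, by rintro _ ⟨x, hx, rfl⟩; exact hsS x (hDG hx), hDc.image s, ?_⟩
    refine Subset.antisymm ?_ (by simpa [sUnion_image] using hD)
    rw [sUnion_image]
    exact iUnion₂_subset fun x hx => hsG x (hDG hx)
  refine le_of_forall_lt fun r hr => ?_
  obtain ⟨t, htC, htr⟩ : ∃ t : Finset (Set ℝ), (∀ s ∈ t, s ∈ C) ∧ r < μ (⋃ s ∈ t, s) := by
    have hCne : C.Nonempty := by
      by_contra hC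
      rw [not_nonempty_iff_eq_empty] at hC
      simp [← hCG, hC] at hr
    obtain ⟨c, rfl⟩ := hCc.exists_eq_range hCne
    have hacc : Tendsto (fun n => μ (accumulate c n)) atTop (𝓝 (μ (⋃ n, c n))) :=
      tendsto_measure_iUnion_accumulate
    rw [← sUnion_range, hCG] at hacc
    obtain ⟨n, hn⟩ := ((tendsto_order.1 hacc).1 r hr).exists
    refine ⟨(Finset.range (n + 1)).image c, by simp, hn.trans_le (measure_mono ?_)⟩
    exact iUnion₂_subset fun k hk => subset_biUnion_of_mem
      (u := fun s : Set ℝ => s) (Finset.mem_coe.2 (Finset.mem_image_of_mem c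
        (Finset.mem_range.2 (Nat.lt_succ_of_le hk))))
  have hlim := hSpi.tendsto_measureReal_biUnion (μ := μs) (ν := μ) (l := atTop)
    (fun s hs => hCS (htC s hs)) hSmeas hSlim
  have hlim' : Tendsto (fun n => μs n (⋃ s ∈ t, s)) atTop (𝓝 (μ (⋃ s ∈ t, s))) :=
    (ENNReal.tendsto_toReal_iff (fun n => measure_ne_top _ _) (measure_ne_top _ _)).1 hlim
  have htG : (⋃ s ∈ t, s) ⊆ G := by
    rw [← hCG]
    exact iUnion₂_subset fun s hs => subset_sUnion_of_mem (htC s hs)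
  calc r < μ (⋃ s ∈ t, s) := htr
    _ = liminf (fun n => μs n (⋃ s ∈ t, s)) atTop := hlim'.liminf_eq.symm
    _ ≤ liminf (fun n => μs n G) atTop :=
      liminf_le_liminf (Eventually.of_forall fun n => measure_mono htG)

/-- Measurability of parametric integrals against a measurable family of finite measures. -/
theorem measurable_lintegral_of_isFiniteMeasure {α β : Type*} [MeasurableSpace α]
    [MeasurableSpace β] {μ : α → Measure β} [∀ a, IsFiniteMeasure (μ a)] (hμ : Measurable μ)
    {f : α × β → ENNReal} (hf : Measurable f) :
    Measurable fun a => ∫⁻ b, f (a, b) ∂(μ a) := by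
  have hmass : Measurable fun a => 1 + μ a univ :=
    (Measure.measurable_coe MeasurableSet.univ).comp hμ |>.const_add 1
  -- Dividing by one plus the mass gives a finite kernel without excluding zero mass.
  let κ : ProbabilityTheory.Kernel α β :=
    ⟨fun a => (1 + μ a univ)⁻¹ • μ a, Measure.measurable_of_measurable_coe _ fun s hs => by
      simpa using! hmass.inv.mul ((Measure.measurable_coe hs).comp hμ)⟩
  have hκ : ProbabilityTheory.IsFiniteKernel κ := by
    refine ⟨1, ENNReal.one_lt_top, fun a => ?_⟩
    change ((1 + μ a univ)⁻¹ • μ a) univ ≤ 1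
    rw [Measure.smul_apply, smul_eq_mul, ← ENNReal.div_eq_inv_mul]
    exact ENNReal.div_le_of_le_mul (by simp)
  have h := hmass.mul (Measurable.lintegral_kernel_prod_right (κ := κ) (f := fun a b => f (a, b)) hf)
  convert! h using 2 with a
  change _ = (1 + μ a univ) * ∫⁻ b, f (a, b) ∂((1 + μ a univ)⁻¹ • μ a)
  rw [lintegral_smul_measure, smul_eq_mul, ← mul_assoc, ENNReal.mul_inv_cancel, one_mul]
  · simp
  · finiteness

theorem measurable_pi_iInf {Ω ι : Type*} {m : MeasurableSpace Ω} {v : ℕ → Ω → ι → ℝ}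
    (hv : ∀ n, Measurable (v n)) : Measurable fun ω l => ⨅ n, v n ω l :=
  measurable_pi_iff.2 fun l => .iInf fun n => measurable_pi_iff.1 (hv n) l

theorem measurable_pi_iSup {Ω ι : Type*} {m : MeasurableSpace Ω} {v : ℕ → Ω → ι → ℝ}
    (hv : ∀ n, Measurable (v n)) : Measurable fun ω l => ⨆ n, v n ω l :=
  measurable_pi_iff.2 fun l => .iSup fun n => measurable_pi_iff.1 (hv n) l

/-! ### The lattice of strategies. -/

namespace MonotoneFollowerGame

section

variable {Ω : Type*} [MeasurableSpace Ω] {N k d : ℕ} {G : MonotoneFollowerGame Ω N k d}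
  {P : Measure Ω} [P.IsComplete]

/-- Lebesgue measure on `[0, T]` together with a unit mass at `T`. -/
noncomputable def timeMeasure (G : MonotoneFollowerGame Ω N k d) : Measure ℝ :=
  volume.restrict (Icc 0 G.T) + Measure.dirac G.T

instance : IsFiniteMeasure G.timeMeasure := by
  unfold timeMeasure; infer_instance

theorem ae_timeMeasure_iff {p : ℝ → Prop} :
    (∀ᵐ t ∂G.timeMeasure, p t) ↔ (∀ᵐ t ∂volume.restrict (Icc 0 G.T), p t) ∧ p G.T := by
  rw [timeMeasure, ae_add_measure_iff, ae_dirac_eq]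
  rfl

theorem clock_coe (t : Icc (0 : ℝ) G.T) : G.clock t = t := projIcc_val _ t

theorem clock_of_le {t : ℝ} (ht : t ≤ 0) : G.clock t = G.tZero := projIcc_of_le_left _ ht

theorem clock_of_ge {t : ℝ} (ht : G.T ≤ t) : G.clock t = G.tEnd := projIcc_of_right_le _ ht

theorem continuousWithinAt_comp_clock {E : Type*} [TopologicalSpace E]
    {x : Icc (0 : ℝ) G.T → E} (hx : IsCadlagPath x) (t : ℝ) :
    ContinuousWithinAt (fun s => x (G.clock s)) (Ici t) t :=
  (hx (G.clock t)).1.comp (t := Ici (G.clock t))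
    (continuous_projIcc (h := G.T_pos.le)).continuousWithinAt
    fun _ h => monotone_projIcc G.T_pos.le h

theorem filtration_eq_iInf (t : Icc (0 : ℝ) G.T) (ht : t < G.tEnd) :
    G.filtration P t = ⨅ s > t, G.filtration P s := by
  have h : G.filtration P = (G.filtration P).rightCont := by
    rw [filtration, Filtration.rightCont_self]
  have ht' : ¬ IsMax t := fun h => (not_lt_of_ge (h ht.le)) ht
  conv_lhs => rw [h]
  exact Filtration.rightCont_eq_of_not_isMax _ ht'

theorem measurableSet_filtration_of_null {s : Set Ω} (hs : P s = 0) (t : Icc (0 : ℝ) G.T) :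
    MeasurableSet[G.filtration P t] s := by
  refine Filtration.le_rightCont (augmentNull P G.rawFiltration) t _ ?_
  exact (le_sup_right : MeasurableSpace.generateFrom {s | P s = 0} ≤ _) s
    (MeasurableSpace.measurableSet_generateFrom hs)

namespace Strategy

/-- The path of a strategy, extended to all real times by its values at `0` and `T`. -/
noncomputable def path (A : G.Strategy P) (ω : Ω) (t : ℝ) : Fin d → ℝ := A.val (G.clock t) ω

theorem path_mono (A : G.Strategy P) (ω : Ω) : Monotone (A.path ω) :=
  fun _ _ h => A.mono ω (monotone_projIcc _ h)

theorem path_nonneg (A : G.Strategy P) (ω : Ω) (t : ℝ) : 0 ≤ A.path ω t := A.nonneg _ ω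

theorem path_T (A : G.Strategy P) (ω : Ω) : A.path ω G.T = A.val G.tEnd ω :=
  congrArg (A.val · ω) (clock_of_ge le_rfl)

theorem continuousWithinAt_path (A : G.Strategy P) (ω : Ω) (t : ℝ) :
    ContinuousWithinAt (A.path ω) (Ici t) t :=
  continuousWithinAt_comp_clock (A.cadlag ω) t

theorem measurable_val (A : G.Strategy P) (t : Icc (0 : ℝ) G.T) : Measurable (A.val t) :=
  (A.adapted t).mono ((G.filtration P).le t) le_rfl

theorem measurable_path (A : G.Strategy P) : Measurable fun p : Ω × ℝ => A.path p.1 p.2 :=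
  measurable_uncurry_of_continuousWithinAt_Ici (fun t => A.measurable_val (G.clock t))
    A.continuousWithinAt_path

theorem le_of_ae_path_le {A B : G.Strategy P}
    (h : ∀ᵐ ω ∂P, ∀ᵐ t ∂G.timeMeasure, A.path ω t ≤ B.path ω t) : A ≤ B := by
  filter_upwards [h] with ω hω t
  rw [ae_timeMeasure_iff] at hω
  have := forall_le_of_ae_le (A.continuousWithinAt_path ω) (B.continuousWithinAt_path ω)
    hω.1 hω.2 t.2
  rwa [path, path, clock_coe] at this

theorem ae_path_le {A B : G.Strategy P} (h : A ≤ B) : ∀ᵐ ω ∂P, ∀ t, A.path ω t ≤ B.path ω t := by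
  filter_upwards [h] with ω hω t using hω _

instance : Zero (G.Strategy P) where
  zero :=
    { val := fun _ _ => 0
      adapted := fun _ => measurable_const
      cadlag := fun _ _ => ⟨continuousWithinAt_const, 0, tendsto_const_nhds⟩
      mono := fun _ => monotone_const
      nonneg := fun _ _ => le_rfl }

theorem zero_le (A : G.Strategy P) : 0 ≤ A := Eventually.of_forall fun ω t => A.nonneg t ω

/-- Combine two strategies by a continuous nondecreasing operation. -/
def map₂ (φ : (Fin d → ℝ) → (Fin d → ℝ) → Fin d → ℝ) (hφ : Continuous fun p : _ × _ => φ p.1 p.2)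
    (hmono : ∀ {a a' b b'}, a ≤ a' → b ≤ b' → φ a b ≤ φ a' b') (h0 : 0 ≤ φ 0 0)
    (A B : G.Strategy P) : G.Strategy P where
  val t ω := φ (A.val t ω) (B.val t ω)
  adapted t := hφ.measurable.comp ((A.adapted t).prodMk (B.adapted t))
  cadlag ω := Monotone.isCadlagPath (fun _ _ h => hmono (A.mono ω h) (B.mono ω h)) fun t =>
    hφ.continuousAt.comp_continuousWithinAt ((A.cadlag ω t).1.prodMk (B.cadlag ω t).1)
  mono ω _ _ h := hmono (A.mono ω h) (B.mono ω h)
  nonneg t ω := h0.trans (hmono (A.nonneg t ω) (B.nonneg t ω))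

instance : Min (G.Strategy P) where
  min A B := map₂ (· ⊓ ·)
    (continuous_pi fun l => by simp only [Pi.inf_apply]; fun_prop) inf_le_inf (le_inf le_rfl le_rfl) A B

instance : Max (G.Strategy P) where
  max A B := map₂ (· ⊔ ·)
    (continuous_pi fun l => by simp only [Pi.sup_apply]; fun_prop) sup_le_sup le_sup_left A B

theorem min_le_left (A B : G.Strategy P) : A ⊓ B ≤ A :=
  Eventually.of_forall fun _ _ => inf_le_left

theorem le_max_left (A B : G.Strategy P) : A ≤ A ⊔ B :=
  Eventually.of_forall fun _ _ => le_sup_left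

theorem le_max_right (A B : G.Strategy P) : B ≤ A ⊔ B :=
  Eventually.of_forall fun _ _ => le_sup_right

theorem max_le {A B C : G.Strategy P} (hA : A ≤ C) (hB : B ≤ C) : A ⊔ B ≤ C := by
  filter_upwards [hA, hB] with ω h₁ h₂ t using sup_le (h₁ t) (h₂ t)

/-- The average of two strategies. -/
noncomputable def average (A B : G.Strategy P) : G.Strategy P :=
  map₂ (fun a b => (1 / 2 : ℝ) • a + (1 / 2 : ℝ) • b) (by fun_prop)
    (fun h h' => by gcongr) (by simp) A B

theorem path_average (A B : G.Strategy P) (ω : Ω) (t : ℝ) :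
    (average A B).path ω t = (1 / 2 : ℝ) • A.path ω t + (1 / 2 : ℝ) • B.path ω t := rfl

theorem bddBelow_range_val (V : ℕ → G.Strategy P) (t : Icc (0 : ℝ) G.T) (ω : Ω) (l : Fin d) :
    BddBelow (range fun n => (V n).val t ω l) :=
  ⟨0, by rintro _ ⟨n, rfl⟩; exact (V n).nonneg t ω l⟩

/-- The pathwise infimum of a sequence of strategies. -/
noncomputable def seqInf (V : ℕ → G.Strategy P) : G.Strategy P where
  val t ω l := ⨅ n, (V n).val t ω l
  adapted t := measurable_pi_iInf fun n => (V n).adapted t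
  cadlag ω := Monotone.isCadlagPath
    (fun s t h l => ciInf_mono (bddBelow_range_val V s ω l) fun n => (V n).mono ω h l) fun t => by
      refine continuousWithinAt_pi.2 fun l => ?_
      -- The lower bound is monotonicity. The upper one holds since a single `V n` already lies
      -- below the level just after `t`; hence infima need no regularization.
      refine tendsto_order.2 ⟨fun a ha => ?_, fun a ha => ?_⟩
      · filter_upwards [self_mem_nhdsWithin] with s hs
        exact ha.trans_le (ciInf_mono (bddBelow_range_val V t ω l) fun n => (V n).mono ω hs l)
      · obtain ⟨n, hn⟩ := exists_lt_of_ciInf_lt ha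
        have h := continuousWithinAt_pi.1 ((V n).cadlag ω t).1 l
        filter_upwards [h.eventually_lt_const hn] with s hs
        exact (ciInf_le (bddBelow_range_val V s ω l) n).trans_lt hs
  mono ω s t h l := ciInf_mono (bddBelow_range_val V s ω l) fun n => (V n).mono ω h l
  nonneg t ω l := le_ciInf fun n => (V n).nonneg t ω l

theorem seqInf_le (V : ℕ → G.Strategy P) (n : ℕ) : seqInf V ≤ V n :=
  Eventually.of_forall fun ω t l => ciInf_le (bddBelow_range_val V t ω l) n

theorem le_seqInf {V : ℕ → G.Strategy P} {B : G.Strategy P} (h : ∀ n, B ≤ V n) : B ≤ seqInf V := by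
  filter_upwards [ae_all_iff.2 h] with ω hω t l using le_ciInf fun n => hω n t l

theorem tendsto_path_seqInf {V : ℕ → G.Strategy P} (hV : Antitone V) :
    ∀ᵐ ω ∂P, ∀ t, Tendsto (fun n => (V n).path ω t) atTop (𝓝 ((seqInf V).path ω t)) := by
  filter_upwards [ae_all_iff.2 fun n : ℕ => hV n.le_succ] with ω hω t
  refine tendsto_pi_nhds.2 fun l => tendsto_atTop_ciInf ?_ (bddBelow_range_val V (G.clock t) ω l)
  exact antitone_nat_of_succ_le fun n => hω n _ l

end Strategy

end

end MonotoneFollowerGame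

/-! ### Limits of increasing sequences of strategies. -/

theorem measurable_pi_of_tendsto {Ω ι : Type*} {m : MeasurableSpace Ω} {v : ℕ → Ω → ι → ℝ}
    {w : Ω → ι → ℝ} (hv : ∀ n, Measurable (v n))
    (h : ∀ ω l, Tendsto (fun n => v n ω l) atTop (𝓝 (w ω l))) : Measurable w :=
  measurable_pi_iff.2 fun l => measurable_of_tendsto_metrizable
    (fun n => measurable_pi_iff.1 (hv n) l) (tendsto_pi_nhds.2 fun ω => h ω l)

namespace MonotoneFollowerGame

section

variable {Ω : Type*} [MeasurableSpace Ω] {N k d : ℕ} {G : MonotoneFollowerGame Ω N k d}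
  {P : Measure Ω} [P.IsComplete]

namespace Strategy

open Classical in
/-- Set a strategy to zero on a null set. -/
noncomputable def zeroOn (A : G.Strategy P) (s : Set Ω) (hs : P s = 0) : G.Strategy P where
  val t ω := if ω ∈ s then 0 else A.val t ω
  adapted t := Measurable.ite (measurableSet_filtration_of_null hs t) measurable_const (A.adapted t)
  cadlag ω := by
    by_cases h : ω ∈ s
    · simp only [h, if_true]
      exact (0 : G.Strategy P).cadlag ω
    · simpa only [h, if_false] using A.cadlag ω
  mono ω := by
    by_cases h : ω ∈ s
    · simpa only [h, if_true] using monotone_const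
    · simpa only [h, if_false] using A.mono ω
  nonneg t ω := by
    by_cases h : ω ∈ s
    · simp [h]
    · simpa only [h, if_false] using A.nonneg t ω

theorem path_zeroOn_of_notMem (A : G.Strategy P) {s : Set Ω} (hs : P s = 0) {ω : Ω} (h : ω ∉ s) :
    (A.zeroOn s hs).path ω = A.path ω := by
  funext t
  exact if_neg h

theorem path_zeroOn_of_mem (A : G.Strategy P) {s : Set Ω} (hs : P s = 0) {ω : Ω} (h : ω ∈ s) :
    (A.zeroOn s hs).path ω = 0 := by
  funext t
  exact if_pos h

section seqSup

variable (V : ℕ → G.Strategy P) (hV : ∀ ω l, BddAbove (range fun n => (V n).path ω G.T l))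

include hV in
theorem bddAbove_range_path (ω : Ω) (t : ℝ) (l : Fin d) :
    BddAbove (range fun n => (V n).path ω t l) := by
  obtain ⟨c, hc⟩ := hV ω l
  refine ⟨c, ?_⟩
  rintro _ ⟨n, rfl⟩
  refine le_trans ?_ (hc ⟨n, rfl⟩)
  change (V n).path ω t l ≤ (V n).path ω G.T l
  rw [path_T]
  exact (V n).mono ω (G.clock t).2.2 l

include hV in
theorem monotone_iSup_path (ω : Ω) (l : Fin d) : Monotone fun t => ⨆ n, (V n).path ω t l :=
  fun _ t h => ciSup_mono (bddAbove_range_path V hV ω t l) fun n => (V n).path_mono ω h l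

theorem measurable_iSup_path (t : ℝ) {s : Icc (0 : ℝ) G.T} (hts : G.clock t ≤ s) :
    Measurable[G.filtration P s] fun ω l => ⨆ n, (V n).path ω t l :=
  measurable_pi_iSup fun n => ((V n).adapted (G.clock t)).mono ((G.filtration P).mono hts) le_rfl

theorem rightLim_iSup_path_T (ω : Ω) (l : Fin d) :
    Function.rightLim (fun t => ⨆ n, (V n).path ω t l) G.T = ⨆ n, (V n).path ω G.T l := by
  refine rightLim_eq_of_tendsto (tendsto_const_nhds.congr' ?_)
  filter_upwards [self_mem_nhdsWithin] with t ht
  simp only [path, clock_of_ge (le_of_lt ht), clock_of_ge le_rfl]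

/-- The right-continuous regularization of the supremum of a bounded sequence of strategies. -/
noncomputable def seqSup : G.Strategy P where
  val t ω l := Function.rightLim (fun t => ⨆ n, (V n).path ω t l) t
  adapted t := by
    -- Before the horizon, the right limit is measurable at every later time, so right-continuity of
    -- the filtration is essential. At the horizon the paths are constant to the right, and no limit
    -- is involved.
    rcases lt_or_ge t G.tEnd with ht | ht
    · rw [filtration_eq_iInf t ht, measurable_iff_comap_le]
      refine le_iInf₂ fun s hs => ?_
      rw [← measurable_iff_comap_le]
      obtain ⟨u, -, hu, hlim⟩ := exists_seq_strictAnti_tendsto' (show (t : ℝ) < s from hs)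
      refine measurable_pi_of_tendsto (v := fun m ω l => ⨆ n, (V n).path ω (u m) l)
        (fun m => ?_) fun ω l => ?_
      · refine measurable_iSup_path V (u m) ?_
        rw [← clock_coe s]
        exact monotone_projIcc _ (hu m).2.le
      · exact ((monotone_iSup_path V hV ω l).tendsto_rightLim t).comp
          (tendsto_nhdsWithin_iff.2 ⟨hlim, Eventually.of_forall fun m => (hu m).1⟩)
    · obtain rfl : t = G.tEnd := le_antisymm t.2.2 ht
      have h := measurable_iSup_path V G.T (s := G.tEnd) (clock_of_ge le_rfl).le
      convert! h using 3
      exact rightLim_iSup_path_T V _ _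
  cadlag ω := Monotone.isCadlagPath
    (fun _ _ h l => (monotone_iSup_path V hV ω l).rightLim h) fun t =>
      continuousWithinAt_pi.2 fun l =>
        ((monotone_iSup_path V hV ω l).stieltjesFunction.right_continuous t).comp
          (t := Ici (t : ℝ)) continuous_subtype_val.continuousWithinAt fun _ h => h
  mono ω _ _ h l := (monotone_iSup_path V hV ω l).rightLim h
  nonneg t ω l := (le_ciSup_of_le (bddAbove_range_path V hV ω t l) 0
    ((V 0).path_nonneg ω t l)).trans ((monotone_iSup_path V hV ω l).le_rightLim le_rfl)

theorem path_seqSup (ω : Ω) (t : ℝ) (l : Fin d) : (seqSup V hV).path ω t l =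
    Function.rightLim (fun t => ⨆ n, (V n).path ω t l) (G.clock t) := rfl

/-- A monotone path has countably many discontinuities, so regularization changes it only on a
Lebesgue null set, and it does not change the value at `T`. -/
theorem ae_path_seqSup (ω : Ω) :
    ∀ᵐ t ∂G.timeMeasure, ∀ l, (seqSup V hV).path ω t l = ⨆ n, (V n).path ω t l := by
  refine ae_all_iff.2 fun l => ae_timeMeasure_iff.2 ⟨?_, ?_⟩
  · have hc := (monotone_iSup_path V hV ω l).countable_not_continuousAt
    filter_upwards [ae_restrict_of_ae (hc.ae_notMem volume), ae_restrict_mem measurableSet_Icc] with t ht htI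
    have hcont : ContinuousAt (fun t => ⨆ n, (V n).path ω t l) t := by
      by_contra h
      exact ht h
    rw [path_seqSup, clock, projIcc_of_mem _ htI]
    exact hcont.continuousWithinAt.rightLim_eq
  · rw [path_seqSup, clock_of_ge le_rfl]
    exact rightLim_iSup_path_T V ω l

end seqSup

/-- By Fatou the lower limit of the terminal norms is almost surely finite; by monotonicity it
controls the whole sequence. -/
theorem ae_bddAbove_of_expectedTerminalNorm_le {V : ℕ → G.Strategy P} (hV : Monotone V)
    {C : ENNReal} (hC : C ≠ ⊤) (hVC : ∀ n, (V n).expectedTerminalNorm ≤ C) :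
    ∀ᵐ ω ∂P, ∀ l, BddAbove (range fun n => (V n).path ω G.T l) := by
  have hmeas : ∀ n, Measurable fun ω => ‖WithLp.toLp 2 ((V n).val G.tEnd ω)‖ₑ := fun n =>
    ((WithLp.measurable_toLp 2 _).comp ((V n).measurable_val G.tEnd)).enorm
  have hlim : ∫⁻ ω, liminf (fun n => ‖WithLp.toLp 2 ((V n).val G.tEnd ω)‖ₑ) atTop ∂P ≤ C :=
    (lintegral_liminf_le hmeas).trans
      (liminf_le_of_frequently_le' (Frequently.of_forall hVC))
  have hfin := ae_lt_top (Measurable.liminf hmeas) (ne_top_of_le_ne_top hC hlim)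
  filter_upwards [hfin, ae_all_iff.2 fun n : ℕ => hV n.le_succ] with ω hω hmono l
  obtain ⟨c, hc, hc'⟩ := exists_between hω
  have hfreq := frequently_lt_of_liminf_lt (by isBoundedDefault) hc
  refine ⟨c.toReal, ?_⟩
  rintro _ ⟨n, rfl⟩
  obtain ⟨m, hnm, hm⟩ := (hfreq.and_eventually (eventually_ge_atTop n)).exists.imp fun _ h => h.symm
  have h1 : (V n).path ω G.T l ≤ (V m).path ω G.T l :=
    monotone_nat_of_le_succ (f := fun n => (V n).path ω G.T l) (fun n => hmono n _ l) hnm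
  have h2 : (V m).path ω G.T l ≤ ‖WithLp.toLp 2 ((V m).val G.tEnd ω)‖ := by
    rw [path_T]
    exact (le_abs_self _).trans (PiLp.norm_apply_le (WithLp.toLp 2 ((V m).val G.tEnd ω)) l)
  have h3 : ‖WithLp.toLp 2 ((V m).val G.tEnd ω)‖ ≤ c.toReal := by
    rw [← toReal_enorm]
    exact ENNReal.toReal_mono hc'.ne hm.le
  exact h1.trans (h2.trans h3)

/-- An increasing sequence of strategies whose terminal values are bounded in expectation converges
at almost every time, and at the terminal time, to a strategy. -/
theorem exists_tendsto_path_of_monotone {V : ℕ → G.Strategy P} (hV : Monotone V)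
    {C : ENNReal} (hC : C ≠ ⊤) (hVC : ∀ n, (V n).expectedTerminalNorm ≤ C) :
    ∃ S : G.Strategy P, ∀ᵐ ω ∂P, ∀ᵐ t ∂G.timeMeasure,
      Tendsto (fun n => (V n).path ω t) atTop (𝓝 (S.path ω t)) := by
  have hb := ae_bddAbove_of_expectedTerminalNorm_le hV hC hVC
  -- `seqSup` needs boundedness for every `ω`; the exceptional null set is removed first,
  -- adaptedness being kept since the filtration contains null sets.
  set s : Set Ω := {ω | ¬ ∀ l, BddAbove (range fun n => (V n).path ω G.T l)}
  have hs : P s = 0 := hb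
  let W : ℕ → G.Strategy P := fun n => (V n).zeroOn s hs
  have hW : ∀ ω l, BddAbove (range fun n => (W n).path ω G.T l) := fun ω l => by
    by_cases h : ω ∈ s
    · simp [W, path_zeroOn_of_mem _ hs h]
    · simpa only [W, path_zeroOn_of_notMem _ hs h] using not_not.1 h l
  refine ⟨seqSup W hW, ?_⟩
  filter_upwards [hb, ae_all_iff.2 fun n : ℕ => hV n.le_succ] with ω hω hmono
  have hωs : ω ∉ s := not_not.2 hω
  filter_upwards [ae_path_seqSup W hW ω] with t ht
  refine tendsto_pi_nhds.2 fun l => ?_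
  have hbdd := bddAbove_range_path W hW ω t l
  rw [ht l]
  simp only [W, path_zeroOn_of_notMem _ hs hωs] at hbdd ⊢
  exact tendsto_atTop_ciSup (monotone_nat_of_le_succ fun n => hmono n _ l) hbdd

theorem le_of_ae_tendsto_path {V : ℕ → G.Strategy P} (hV : Monotone V) {S : G.Strategy P}
    (h : ∀ᵐ ω ∂P, ∀ᵐ t ∂G.timeMeasure, Tendsto (fun n => (V n).path ω t) atTop (𝓝 (S.path ω t)))
    (n : ℕ) : V n ≤ S := by
  refine le_of_ae_path_le ?_
  filter_upwards [h, ae_all_iff.2 fun m : ℕ => ae_path_le (hV (Nat.le_add_right n m))] with ω hω hle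
  filter_upwards [hω] with t ht
  exact ge_of_tendsto' (ht.comp (tendsto_add_atTop_nat n)) fun m => by
    rw [Function.comp_apply, add_comm]
    exact hle m t

theorem ae_tendsto_path_le {V : ℕ → G.Strategy P} {S B : G.Strategy P}
    (h : ∀ᵐ ω ∂P, ∀ᵐ t ∂G.timeMeasure, Tendsto (fun n => (V n).path ω t) atTop (𝓝 (S.path ω t)))
    (hB : ∀ n, V n ≤ B) : S ≤ B := by
  refine le_of_ae_path_le ?_
  filter_upwards [h, ae_all_iff.2 fun n => ae_path_le (hB n)] with ω hω hle
  filter_upwards [hω] with t ht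
  exact le_of_tendsto' ht fun n => hle n t

end Strategy

end

end MonotoneFollowerGame

/-! ### The control cost: measurability, additivity, lower semicontinuity. -/

theorem ENNReal.liminf_add_liminf_le (u v : ℕ → ENNReal) :
    liminf u atTop + liminf v atTop ≤ liminf (fun n => u n + v n) atTop := by
  simp only [liminf_eq_iSup_iInf_of_nat]
  rw [ENNReal.iSup_add_iSup_of_monotone]
  · exact iSup_mono fun n => le_iInf₂ fun m hm => add_le_add (iInf₂_le m hm) (iInf₂_le m hm)
  · exact fun a b hab => le_iInf₂ fun m hm => iInf₂_le m (hab.trans hm)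
  · exact fun a b hab => le_iInf₂ fun m hm => iInf₂_le m (hab.trans hm)

theorem ENNReal.sum_liminf_le {ι : Type*} (s : Finset ι) (u : ι → ℕ → ENNReal) :
    ∑ i ∈ s, liminf (u i) atTop ≤ liminf (fun n => ∑ i ∈ s, u i n) atTop := by
  classical
  induction s using Finset.induction_on with
  | empty => simp
  | insert a s ha ih =>
    simp only [Finset.sum_insert ha]
    exact (add_le_add_right ih _).trans (ENNReal.liminf_add_liminf_le _ _)

namespace MonotoneFollowerGame

section

variable {Ω : Type*} [MeasurableSpace Ω] {N k d : ℕ} {G : MonotoneFollowerGame Ω N k d}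
  {P : Measure Ω} [P.IsComplete]

namespace Strategy

theorem stieltjes_apply (A : G.Strategy P) (ω : Ω) (l : Fin d) (t : ℝ) :
    A.stieltjes ω l t = A.path ω t l := rfl

theorem path_of_nonpos (A : G.Strategy P) (ω : Ω) {t : ℝ} (ht : t ≤ 0) :
    A.path ω t = A.path ω 0 := by
  rw [path, path, clock_of_le ht, clock_of_le le_rfl]

theorem path_of_ge (A : G.Strategy P) (ω : Ω) {t : ℝ} (ht : G.T ≤ t) :
    A.path ω t = A.path ω G.T := by
  rw [path, path, clock_of_ge ht, clock_of_ge le_rfl]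

theorem tendsto_stieltjes_atBot (A : G.Strategy P) (ω : Ω) (l : Fin d) :
    Tendsto (A.stieltjes ω l) atBot (𝓝 (A.path ω 0 l)) :=
  tendsto_const_nhds.congr' <| by
    filter_upwards [eventually_le_atBot 0] with t ht
    rw [stieltjes_apply, A.path_of_nonpos ω ht]

theorem tendsto_stieltjes_atTop (A : G.Strategy P) (ω : Ω) (l : Fin d) :
    Tendsto (A.stieltjes ω l) atTop (𝓝 (A.path ω G.T l)) :=
  tendsto_const_nhds.congr' <| by
    filter_upwards [eventually_ge_atTop G.T] with t ht
    rw [stieltjes_apply, A.path_of_ge ω ht]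

instance (A : G.Strategy P) (ω : Ω) (l : Fin d) : IsFiniteMeasure (A.stieltjes ω l).measure :=
  (A.stieltjes ω l).isFiniteMeasure (A.tendsto_stieltjes_atBot ω l) (A.tendsto_stieltjes_atTop ω l)

/-- The Lebesgue–Stieltjes measure on `[0, T]` of a component of a strategy, including the mass of
the initial jump. -/
noncomputable def jumpMeasure (A : G.Strategy P) (ω : Ω) (l : Fin d) : Measure ℝ :=
  ENNReal.ofReal (A.path ω 0 l) • Measure.dirac 0 + (A.stieltjes ω l).measure

instance (A : G.Strategy P) (ω : Ω) (l : Fin d) : IsFiniteMeasure (A.jumpMeasure ω l) := by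
  have : IsFiniteMeasure (ENNReal.ofReal (A.path ω 0 l) • Measure.dirac (0 : ℝ)) :=
    Measure.smul_finite _ ENNReal.ofReal_ne_top
  unfold jumpMeasure
  infer_instance

/-- Counting the initial value as an atom at `0` makes the path itself the distribution function, so
convergence of paths becomes convergence of distribution functions. -/
theorem jumpMeasure_Iic (A : G.Strategy P) (ω : Ω) (l : Fin d) (t : ℝ) :
    A.jumpMeasure ω l (Iic t) = if 0 ≤ t then ENNReal.ofReal (A.path ω t l) else 0 := by
  rw [jumpMeasure, Measure.add_apply, Measure.smul_apply, Measure.dirac_apply' _ measurableSet_Iic,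
    StieltjesFunction.measure_Iic _ (A.tendsto_stieltjes_atBot ω l), stieltjes_apply]
  split_ifs with h
  · have h1 : A.path ω 0 l ≤ A.path ω t l := A.path_mono ω h l
    have h0 : 0 ≤ A.path ω 0 l := A.path_nonneg ω 0 l
    simp [h, ← ENNReal.ofReal_add h0 (sub_nonneg.2 h1)]
  · simp [h, A.path_of_nonpos ω (not_le.1 h).le]

theorem jumpMeasure_univ (A : G.Strategy P) (ω : Ω) (l : Fin d) :
    A.jumpMeasure ω l univ = ENNReal.ofReal (A.path ω G.T l) := by
  have h1 : A.path ω 0 l ≤ A.path ω G.T l := A.path_mono ω G.T_pos.le l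
  have h0 : 0 ≤ A.path ω 0 l := A.path_nonneg ω 0 l
  rw [jumpMeasure, Measure.add_apply, StieltjesFunction.measure_univ _
    (A.tendsto_stieltjes_atBot ω l) (A.tendsto_stieltjes_atTop ω l)]
  simp [← ENNReal.ofReal_add h0 (sub_nonneg.2 h1)]

theorem controlCost_eq (A : G.Strategy P) (i : Fin N) (ω : Ω) :
    A.controlCost i ω =
      ∑ l, ∫⁻ t, ENNReal.ofReal (G.f i (G.clock t) ω l) ∂(A.jumpMeasure ω l) := by
  refine Finset.sum_congr rfl fun l _ => ?_
  have hres : (A.stieltjes ω l).measure.restrict (Ioc 0 G.T) = (A.stieltjes ω l).measure := by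
    refine Measure.restrict_eq_self_of_ae_mem ?_
    have h1 : (A.stieltjes ω l).measure (Iic 0) = 0 := by
      rw [StieltjesFunction.measure_Iic _ (A.tendsto_stieltjes_atBot ω l), stieltjes_apply]
      simp
    have h2 : (A.stieltjes ω l).measure (Ioi G.T) = 0 := by
      rw [StieltjesFunction.measure_Ioi _ (A.tendsto_stieltjes_atTop ω l), stieltjes_apply]
      simp
    filter_upwards [measure_eq_zero_iff_ae_notMem.1 h1, measure_eq_zero_iff_ae_notMem.1 h2]
      with t ht ht'
    exact ⟨not_le.1 ht, not_lt.1 ht'⟩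
  rw [jumpMeasure, lintegral_add_measure, lintegral_smul_measure, lintegral_dirac, hres,
    smul_eq_mul, path, clock_of_le le_rfl, ENNReal.ofReal_mul (G.f_nonneg i _ ω l), mul_comm]

theorem measurable_controlCost (A : G.Strategy P) (i : Fin N) :
    Measurable (A.controlCost i) := by
  have hpath : ∀ t l, Measurable fun ω => A.path ω t l := fun t l =>
    measurable_pi_iff.1 (A.measurable_val (G.clock t)) l
  have hμ : ∀ l, Measurable fun ω => A.jumpMeasure ω l := fun l => by
    refine .measure_of_isPiSystem (borel_eq_generateFrom_Iic ℝ ▸ BorelSpace.measurable_eq)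
      isPiSystem_Iic ?_ ?_
    · rintro _ ⟨t, rfl⟩
      simp only [jumpMeasure_Iic]
      split_ifs
      exacts [(hpath t l).ennreal_ofReal, measurable_const]
    · simp only [jumpMeasure_univ]
      exact (hpath G.T l).ennreal_ofReal
  have hf : Measurable fun p : Ω × ℝ => G.f i (G.clock p.2) p.1 :=
    measurable_uncurry_of_continuousWithinAt_Ici (fun t => G.measurable_f i (G.clock t))
      fun ω t => ((G.continuous_f i ω).comp continuous_projIcc).continuousWithinAt
  have h := Finset.measurable_sum Finset.univ fun l _ =>
    measurable_lintegral_of_isFiniteMeasure (hμ l) (measurable_pi_iff.1 hf l).ennreal_ofReal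
  convert! h using 2 with ω
  rw [controlCost_eq]

/-- The control cost is additive in the path. The four-term form serves both `V ⊓ W`, `V ⊔ W` and
twice the average. -/
theorem controlCost_add {A B C D : G.Strategy P} {ω : Ω}
    (h : ∀ t, A.path ω t + B.path ω t = C.path ω t + D.path ω t) (i : Fin N) :
    A.controlCost i ω + B.controlCost i ω = C.controlCost i ω + D.controlCost i ω := by
  simp only [controlCost_eq, ← Finset.sum_add_distrib, ← lintegral_add_measure]
  refine Finset.sum_congr rfl fun l _ => ?_
  congr 1
  have hs : A.stieltjes ω l + B.stieltjes ω l = C.stieltjes ω l + D.stieltjes ω l := by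
    ext t
    exact congrFun (h t) l
  have h0 : ENNReal.ofReal (A.path ω 0 l) + ENNReal.ofReal (B.path ω 0 l) =
      ENNReal.ofReal (C.path ω 0 l) + ENNReal.ofReal (D.path ω 0 l) := by
    have := congrFun (h 0) l
    simp only [Pi.add_apply] at this
    rw [← ENNReal.ofReal_add (A.path_nonneg ω 0 l) (B.path_nonneg ω 0 l), this,
      ENNReal.ofReal_add (C.path_nonneg ω 0 l) (D.path_nonneg ω 0 l)]
  simp only [jumpMeasure]
  rw [add_add_add_comm, ← add_smul, ← StieltjesFunction.measure_add, h0, hs, add_smul,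
    StieltjesFunction.measure_add, add_add_add_comm]

theorem controlCost_congr {A B : G.Strategy P} {ω : Ω} (h : ∀ t, A.path ω t = B.path ω t)
    (i : Fin N) : A.controlCost i ω = B.controlCost i ω := by
  have hs : ∀ l, A.stieltjes ω l = B.stieltjes ω l := fun l => by
    ext t
    exact congrFun (h t) l
  simp only [controlCost_eq, jumpMeasure, h, hs]

theorem controlCost_le_liminf {V : ℕ → G.Strategy P} {S : G.Strategy P} {ω : Ω}
    (h : ∀ᵐ t ∂G.timeMeasure, Tendsto (fun n => (V n).path ω t) atTop (𝓝 (S.path ω t)))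
    (i : Fin N) : S.controlCost i ω ≤ liminf (fun n => (V n).controlCost i ω) atTop := by
  rw [ae_timeMeasure_iff, ae_restrict_iff' measurableSet_Icc] at h
  have hlim : ∀ l, ∀ᵐ t ∂volume, Tendsto (fun n => (V n).jumpMeasure ω l (Iic t)) atTop
      (𝓝 (S.jumpMeasure ω l (Iic t))) := fun l => by
    filter_upwards [h.1] with t ht
    simp only [jumpMeasure_Iic]
    split_ifs with h0
    · refine ENNReal.tendsto_ofReal (tendsto_pi_nhds.1 ?_ l)
      -- Beyond the horizon the distribution function is the terminal value, which converges thanks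
      -- to the atom of `timeMeasure` at `T`.
      rcases le_total t G.T with hT | hT
      · exact ht ⟨h0, hT⟩
      · simpa only [path_of_ge _ ω hT] using h.2
    · exact tendsto_const_nhds
  simp only [controlCost_eq]
  refine (Finset.sum_le_sum fun l _ => lintegral_le_liminf_of_tendsto_measure_Iic (hlim l)
    (f := fun t => G.f i (G.clock t) ω l) ?_ fun t => G.f_nonneg i _ ω l).trans ?_
  · exact (continuous_apply l).comp ((G.continuous_f i ω).comp
      (continuous_projIcc (h := G.T_pos.le)))
  · exact ENNReal.sum_liminf_le _ _

end Strategy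

end

end MonotoneFollowerGame

/-! ### From pointwise conditions to the cost functional. -/

namespace IsSubmodularCost

variable {N k d : ℕ} {i : Fin N} {φ : (Fin k → ℝ) → (Fin N → Fin d → ℝ) → ℝ}

/-- Submodularity against `a` handles the own strategy; decreasing differences then transfer the
increment from `y` to `x ⊔ y` from `a` to `b`. -/
theorem inf_add_sup_le (hφ : IsSubmodularCost i φ) (l : Fin k → ℝ) {a b : Fin N → Fin d → ℝ}
    (hab : a ≤ b) (x y : Fin d → ℝ) :
    φ l (Function.update a i (x ⊓ y)) + φ l (Function.update b i (x ⊔ y)) ≤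
      φ l (Function.update a i x) + φ l (Function.update b i y) := by
  have h1 := hφ.submodular l a x y
  have h2 := hφ.decreasingDifferences l (Function.update a i y) (Function.update b i (x ⊔ y))
    (update_le_update_iff.2 ⟨le_sup_right, fun j _ => hab j⟩)
  simp only [Function.update_idem, Function.update_self] at h2
  linarith

theorem average_le (hφ : IsSubmodularCost i φ) (l : Fin k → ℝ) (a : Fin N → Fin d → ℝ)
    (x y : Fin d → ℝ) :
    2 * φ l (Function.update a i ((1 / 2 : ℝ) • x + (1 / 2 : ℝ) • y)) ≤
      φ l (Function.update a i x) + φ l (Function.update a i y) := by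
  have h := (hφ.strictConvex l a).convexOn.2 (mem_univ x) (mem_univ y)
    (by norm_num : (0 : ℝ) ≤ 1 / 2) (by norm_num : (0 : ℝ) ≤ 1 / 2) (by norm_num)
  simp only [smul_eq_mul] at h
  linarith

theorem eq_of_le_average (hφ : IsSubmodularCost i φ) (l : Fin k → ℝ) (a : Fin N → Fin d → ℝ)
    {x y : Fin d → ℝ} (h : φ l (Function.update a i x) + φ l (Function.update a i y) ≤
      2 * φ l (Function.update a i ((1 / 2 : ℝ) • x + (1 / 2 : ℝ) • y))) : x = y := by
  by_contra hxy
  have h' := (hφ.strictConvex l a).2 (mem_univ x) (mem_univ y) hxy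
    (by norm_num : (0 : ℝ) < 1 / 2) (by norm_num : (0 : ℝ) < 1 / 2) (by norm_num)
  simp only [smul_eq_mul] at h'
  linarith

end IsSubmodularCost

namespace MonotoneFollowerGame

section

variable {Ω : Type*} [MeasurableSpace Ω] {N k d : ℕ} {G : MonotoneFollowerGame Ω N k d}
  {P : Measure Ω} [P.IsComplete]

/-- The running cost before the horizon and the terminal cost at the horizon. -/
noncomputable def stageCost (G : MonotoneFollowerGame Ω N k d) (i : Fin N) (t : ℝ) :
    (Fin k → ℝ) → (Fin N → Fin d → ℝ) → ℝ :=
  if t < G.T then G.h i else G.g i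

theorem stageCost_nonneg (i : Fin N) (t : ℝ) (l : Fin k → ℝ) (a : Fin N → Fin d → ℝ) :
    0 ≤ G.stageCost i t l a := by
  unfold stageCost
  split_ifs
  exacts [G.h_nonneg i l a, G.g_nonneg i l a]

theorem isSubmodularCost_stageCost (hh : ∀ i, IsSubmodularCost i (G.h i))
    (hg : ∀ i, IsSubmodularCost i (G.g i)) (i : Fin N) (t : ℝ) :
    IsSubmodularCost i (G.stageCost i t) := by
  unfold stageCost
  split_ifs
  exacts [hh i, hg i]

theorem measurable_stageCost (i : Fin N) :
    Measurable fun p : ℝ × (Fin k → ℝ) × (Fin N → Fin d → ℝ) => G.stageCost i p.1 p.2.1 p.2.2 := by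
  have : (fun p : ℝ × (Fin k → ℝ) × (Fin N → Fin d → ℝ) => G.stageCost i p.1 p.2.1 p.2.2) =
      fun p => if p.1 < G.T then G.h i p.2.1 p.2.2 else G.g i p.2.1 p.2.2 := by
    funext p
    unfold stageCost
    split_ifs <;> rfl
  rw [this]
  exact Measurable.ite (measurableSet_lt measurable_fst measurable_const)
    ((G.measurable_h i).comp measurable_snd) ((G.measurable_g i).comp measurable_snd)

theorem measurable_L_clock : Measurable fun p : Ω × ℝ => G.L (G.clock p.2) p.1 :=
  measurable_uncurry_of_continuousWithinAt_Ici (u := fun t ω => G.L (G.clock t) ω)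
    (fun t => G.measurable_L (G.clock t))
    fun ω => continuousWithinAt_comp_clock (G.cadlag_L ω)

/-- The stage cost of player `i` along the path `ω` at time `t`. -/
noncomputable def pathStageCost (i : Fin N) (A : Fin N → G.Strategy P) (ω : Ω) (t : ℝ) : ENNReal :=
  ENNReal.ofReal (G.stageCost i t (G.L (G.clock t) ω) fun j => (A j).path ω t)

theorem measurable_pathStageCost (i : Fin N) (A : Fin N → G.Strategy P) :
    Measurable fun p : Ω × ℝ => pathStageCost i A p.1 p.2 :=
  ((measurable_stageCost i).comp (measurable_snd.prodMk (measurable_L_clock.prodMk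
    (measurable_pi_lambda _ fun j => (A j).measurable_path)))).ennreal_ofReal

theorem pathStageCost_update (i : Fin N) (A : Fin N → G.Strategy P) (V : G.Strategy P) (ω : Ω)
    (t : ℝ) : pathStageCost i (Function.update A i V) ω t =
      ENNReal.ofReal (G.stageCost i t (G.L (G.clock t) ω)
        (Function.update (fun j => (A j).path ω t) i (V.path ω t))) := by
  rw [pathStageCost]
  congr 2
  funext j
  rcases eq_or_ne j i with rfl | hj
  · simp
  · simp [hj]

/-- The total cost of player `i` along the path `ω`. -/
noncomputable def pathCost (i : Fin N) (A : Fin N → G.Strategy P) (ω : Ω) : ENNReal :=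
  ∫⁻ t, pathStageCost i A ω t ∂G.timeMeasure + (A i).controlCost i ω

theorem measurable_pathCost (i : Fin N) (A : Fin N → G.Strategy P) : Measurable (pathCost i A) :=
  ((measurable_pathStageCost i A).lintegral_prod_right').add ((A i).measurable_controlCost i)

theorem cost_eq (i : Fin N) (A : Fin N → G.Strategy P) : cost i A = ∫⁻ ω, pathCost i A ω ∂P := by
  refine lintegral_congr fun ω => ?_
  rw [pathCost, timeMeasure, lintegral_add_measure, lintegral_dirac]
  congr 2
  -- At `T` the stage cost is the terminal cost; Lebesgue measure ignores this point and the atom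
  -- sees only it.
  · rw [← restrict_Ico_eq_restrict_Icc]
    refine setLIntegral_congr_fun measurableSet_Ico fun t ht => ?_
    simp only [pathStageCost, stageCost, if_pos ht.2]
    rfl
  · simp only [pathStageCost, stageCost, lt_irrefl, if_false, clock_of_ge le_rfl, Strategy.path_T]

theorem cost_congr {A B : Fin N → G.Strategy P} (hAB : A ≤ B) (hBA : B ≤ A) (i : Fin N) :
    cost i A = cost i B := by
  rw [cost_eq, cost_eq]
  refine lintegral_congr_ae ?_
  filter_upwards [ae_all_iff.2 fun j => Strategy.ae_path_le (hAB j),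
    ae_all_iff.2 fun j => Strategy.ae_path_le (hBA j)] with ω h1 h2
  have h : ∀ j t, (A j).path ω t = (B j).path ω t := fun j t => le_antisymm (h1 j t) (h2 j t)
  simp only [pathCost, pathStageCost, h, Strategy.controlCost_congr (h i) i]

theorem update_le_update_of_le {A B : Fin N → G.Strategy P} (hAB : A ≤ B) (i : Fin N)
    {V W : G.Strategy P} (hVW : V ≤ W) : Function.update A i V ≤ Function.update B i W :=
  update_le_update_iff.2 ⟨hVW, fun j _ => hAB j⟩

theorem cost_inf_add_cost_sup_le (hh : ∀ i, IsSubmodularCost i (G.h i))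
    (hg : ∀ i, IsSubmodularCost i (G.g i)) {A B : Fin N → G.Strategy P} (hAB : A ≤ B) (i : Fin N)
    (V W : G.Strategy P) :
    cost i (Function.update A i (V ⊓ W)) + cost i (Function.update B i (V ⊔ W)) ≤
      cost i (Function.update A i V) + cost i (Function.update B i W) := by
  simp only [cost_eq]
  rw [← lintegral_add_left (measurable_pathCost _ _), ← lintegral_add_left (measurable_pathCost _ _)]
  refine lintegral_mono_ae ?_
  filter_upwards [ae_all_iff.2 fun j => Strategy.ae_path_le (hAB j)] with ω hω
  have hmeas : ∀ A : Fin N → G.Strategy P, Measurable (pathStageCost i A ω) := fun A =>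
    (measurable_pathStageCost i A).comp measurable_prodMk_left
  simp only [pathCost, Function.update_self]
  rw [add_add_add_comm, add_add_add_comm (∫⁻ t, pathStageCost i (Function.update A i V) ω t ∂_)]
  refine add_le_add ?_ (Strategy.controlCost_add (fun t => ?_) i).le
  · rw [← lintegral_add_left (hmeas _), ← lintegral_add_left (hmeas _)]
    refine lintegral_mono fun t => ?_
    simp only [pathStageCost_update]
    rw [← ENNReal.ofReal_add (stageCost_nonneg ..) (stageCost_nonneg ..),
      ← ENNReal.ofReal_add (stageCost_nonneg ..) (stageCost_nonneg ..)]
    exact ENNReal.ofReal_le_ofReal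
      ((isSubmodularCost_stageCost hh hg i t).inf_add_sup_le _ (fun j => hω j t) _ _)
  · exact inf_add_sup _ _

/-- Fatou's lemma in time and in `ω` for the stage costs, with the lower semicontinuity of the
control cost along each path. -/
theorem cost_update_le_liminf (hh : ∀ i, IsSubmodularCost i (G.h i))
    (hg : ∀ i, IsSubmodularCost i (G.g i)) (A : Fin N → G.Strategy P) (i : Fin N)
    {V : ℕ → G.Strategy P} {S : G.Strategy P}
    (h : ∀ᵐ ω ∂P, ∀ᵐ t ∂G.timeMeasure, Tendsto (fun n => (V n).path ω t) atTop (𝓝 (S.path ω t))) :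
    cost i (Function.update A i S) ≤
      liminf (fun n => cost i (Function.update A i (V n))) atTop := by
  simp only [cost_eq]
  refine (lintegral_mono_ae ?_).trans (lintegral_liminf_le fun n => measurable_pathCost _ _)
  filter_upwards [h] with ω hω
  simp only [pathCost, Function.update_self]
  refine (add_le_add ?_ (Strategy.controlCost_le_liminf hω i)).trans
    (ENNReal.liminf_add_liminf_le _ _)
  refine (lintegral_mono_ae ?_).trans (lintegral_liminf_le fun n =>
    (measurable_pathStageCost i _).comp measurable_prodMk_left)
  filter_upwards [hω] with t ht
  simp only [pathStageCost_update]
  have hlsc := (isSubmodularCost_stageCost hh hg i t).lowerSemicontinuous (G.L (G.clock t) ω)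
    fun j => (A j).path ω t
  have hlsc' : LowerSemicontinuous fun x => ENNReal.ofReal (G.stageCost i t (G.L (G.clock t) ω)
      (Function.update (fun j => (A j).path ω t) i x)) :=
    ENNReal.continuous_ofReal.comp_lowerSemicontinuous hlsc fun _ _ => ENNReal.ofReal_le_ofReal
  exact (hlsc'.le_liminf _).trans ht.liminf_le_liminf_comp

/-- Two strategies whose cost does not exceed that of their average are indistinguishable. -/
theorem le_of_cost_add_cost_le_average (hh : ∀ i, IsSubmodularCost i (G.h i))
    (hg : ∀ i, IsSubmodularCost i (G.g i)) (A : Fin N → G.Strategy P) (i : Fin N)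
    {V W : G.Strategy P} (hfin : cost i (Function.update A i V) + cost i (Function.update A i W) ≠ ⊤)
    (h : cost i (Function.update A i V) + cost i (Function.update A i W) ≤
      2 * cost i (Function.update A i (V.average W))) : V ≤ W := by
  simp only [cost_eq] at h hfin
  rw [← lintegral_add_left (measurable_pathCost _ _)] at h hfin
  rw [← lintegral_const_mul _ (measurable_pathCost _ _)] at h
  have hmeas : ∀ A : Fin N → G.Strategy P, ∀ ω, Measurable (pathStageCost i A ω) := fun A ω =>
    (measurable_pathStageCost i A).comp measurable_prodMk_left
  have hstage : ∀ ω t, 2 * pathStageCost i (Function.update A i (V.average W)) ω t ≤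
      pathStageCost i (Function.update A i V) ω t + pathStageCost i (Function.update A i W) ω t := by
    intro ω t
    simp only [pathStageCost_update]
    rw [← ENNReal.ofReal_add (stageCost_nonneg ..) (stageCost_nonneg ..),
      ← ENNReal.ofReal_ofNat 2, ← ENNReal.ofReal_mul zero_le_two]
    exact ENNReal.ofReal_le_ofReal
      ((isSubmodularCost_stageCost hh hg i t).average_le _ _ _ _)
  have hcontrol : ∀ ω, 2 * (V.average W).controlCost i ω =
      V.controlCost i ω + W.controlCost i ω := fun ω => by
    rw [two_mul]
    refine Strategy.controlCost_add (fun t => ?_) i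
    rw [Strategy.path_average, ← two_smul ℝ, smul_add, smul_smul, smul_smul]
    norm_num
  have hadd : ∀ ω, pathCost i (Function.update A i V) ω + pathCost i (Function.update A i W) ω =
      ∫⁻ t, (pathStageCost i (Function.update A i V) ω t +
        pathStageCost i (Function.update A i W) ω t) ∂G.timeMeasure +
        (V.controlCost i ω + W.controlCost i ω) := fun ω => by
    simp only [pathCost, Function.update_self]
    rw [add_add_add_comm, lintegral_add_left (hmeas _ _)]
  have hmul : ∀ ω, 2 * pathCost i (Function.update A i (V.average W)) ω =
      ∫⁻ t, 2 * pathStageCost i (Function.update A i (V.average W)) ω t ∂G.timeMeasure +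
        (V.controlCost i ω + W.controlCost i ω) := fun ω => by
    simp only [pathCost, Function.update_self]
    rw [mul_add, hcontrol, lintegral_const_mul _ (hmeas _ _)]
  have hpath : ∀ ω, 2 * pathCost i (Function.update A i (V.average W)) ω ≤
      pathCost i (Function.update A i V) ω + pathCost i (Function.update A i W) ω := fun ω => by
    rw [hadd, hmul]
    exact add_le_add_left (lintegral_mono (hstage ω)) _
  -- Convexity orders the integrands and the hypothesis reverses the order of the integrals, so they
  -- agree almost surely. Cancelling the finite control costs, the same argument in time reaches
  -- strict convexity pointwise.
  have heq := ae_eq_of_ae_le_of_lintegral_le (Eventually.of_forall hpath)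
    (ne_top_of_le_ne_top hfin (lintegral_mono hpath))
    ((measurable_pathCost _ _).add (measurable_pathCost _ _)).aemeasurable h
  refine Strategy.le_of_ae_path_le ?_
  filter_upwards [heq, ae_lt_top ((measurable_pathCost _ _).add (measurable_pathCost _ _)) hfin]
    with ω hω hωfin
  rw [hadd, hmul] at hω
  rw [Pi.add_apply, hadd, ENNReal.add_lt_top] at hωfin
  rw [ENNReal.add_left_inj hωfin.2.ne] at hω
  have hS := ae_eq_of_ae_le_of_lintegral_le (Eventually.of_forall (hstage ω))
    (hω ▸ hωfin.1.ne) ((hmeas _ ω).add (hmeas _ ω)).aemeasurable hω.ge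
  filter_upwards [hS] with t ht
  simp only [pathStageCost_update] at ht
  rw [← ENNReal.ofReal_add (stageCost_nonneg ..) (stageCost_nonneg ..),
    ← ENNReal.ofReal_ofNat 2, ← ENNReal.ofReal_mul zero_le_two,
    ENNReal.ofReal_eq_ofReal_iff (mul_nonneg zero_le_two (stageCost_nonneg ..))
      (add_nonneg (stageCost_nonneg ..) (stageCost_nonneg ..))] at ht
  exact ((isSubmodularCost_stageCost hh hg i t).eq_of_le_average _ _ ht.ge).le

/-! ### Minimization by submodularity. -/

namespace Strategy

theorem expectedTerminalNorm_mono {A B : G.Strategy P} (h : A ≤ B) :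
    A.expectedTerminalNorm ≤ B.expectedTerminalNorm := by
  refine lintegral_mono_ae ?_
  filter_upwards [h] with ω hω
  rw [← ofReal_norm, ← ofReal_norm, EuclideanSpace.norm_eq, EuclideanSpace.norm_eq]
  refine ENNReal.ofReal_le_ofReal (Real.sqrt_le_sqrt (Finset.sum_le_sum fun l _ => ?_))
  have h0 : 0 ≤ A.val G.tEnd ω l := A.nonneg G.tEnd ω l
  have h1 : A.val G.tEnd ω l ≤ B.val G.tEnd ω l := hω G.tEnd l
  change ‖A.val G.tEnd ω l‖ ^ 2 ≤ ‖B.val G.tEnd ω l‖ ^ 2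
  rw [Real.norm_of_nonneg h0, Real.norm_of_nonneg (h0.trans h1)]
  gcongr

/-- The suprema `V n ⊔ V (n + 1) ⊔ ⋯ ⊔ V (n + j)`. -/
noncomputable def blockSup (V : ℕ → G.Strategy P) (n : ℕ) : ℕ → G.Strategy P
  | 0 => V n
  | j + 1 => blockSup V n j ⊔ V (n + j + 1)

theorem monotone_blockSup (V : ℕ → G.Strategy P) (n : ℕ) : Monotone (blockSup V n) :=
  monotone_nat_of_le_succ fun _ => le_max_left _ _

/-- Makes the limits of the blocks decrease in the starting index. -/
theorem blockSup_succ_le (V : ℕ → G.Strategy P) (n j : ℕ) :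
    blockSup V (n + 1) j ≤ blockSup V n (j + 1) := by
  induction j with
  | zero => exact le_max_right _ _
  | succ j ih =>
    refine max_le (ih.trans (le_max_left _ _)) ?_
    rw [show n + 1 + j + 1 = n + (j + 1) + 1 by ring]
    exact le_max_right _ _

/-- A submodular, coercive functional that is lower semicontinuous for convergence at almost every
time attains its minimum. -/
theorem exists_forall_le_of_submodular (J : G.Strategy P → ENNReal)
    (hsub : ∀ V W, J (V ⊓ W) + J (V ⊔ W) ≤ J V + J W)
    (hlsc : ∀ (V : ℕ → G.Strategy P) (S : G.Strategy P), (∀ᵐ ω ∂P, ∀ᵐ t ∂G.timeMeasure,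
      Tendsto (fun n => (V n).path ω t) atTop (𝓝 (S.path ω t))) →
        J S ≤ liminf (fun n => J (V n)) atTop)
    (hfin : ∃ V, J V ≠ ⊤)
    (hco : ∀ C ≠ ⊤, ∃ C' ≠ ⊤, ∀ V, J V ≤ C → V.expectedTerminalNorm ≤ C') :
    ∃ V, ∀ W, J V ≤ J W := by
  set m := ⨅ V, J V
  have hm : m ≠ ⊤ := by
    obtain ⟨V, hV⟩ := hfin
    exact ne_top_of_le_ne_top hV (iInf_le J V)
  let ε : ℕ → ENNReal := fun n => 2⁻¹ ^ n
  have hε : ∀ n, ε (n + 1) + ε (n + 1) = ε n := fun n => by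
    simp only [ε, pow_succ]
    rw [← mul_add, ENNReal.inv_two_add_inv_two, mul_one]
  have hε0 : ∀ n, ε n ≠ 0 := fun n => pow_ne_zero _ (by simp)
  have hεtop : ∀ n, ε n ≠ ⊤ := fun n => by finiteness
  have hV : ∀ n, ∃ V, J V < m + ε n := fun n => iInf_lt_iff.1 (ENNReal.lt_add_right hm (hε0 n))
  choose V hV using hV
  -- Each new join costs at most `ε (n + j + 1)`, because the meet costs at least `m`. The extra
  -- term on the left absorbs this, as `ε (n + j)` is twice `ε (n + j + 1)`.
  have hblock : ∀ n j, J (blockSup V n j) + ε (n + j) ≤ m + (ε n + ε n) := by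
    intro n j
    induction j with
    | zero =>
      rw [← add_assoc]
      exact add_le_add_left (hV n).le _
    | succ j ih =>
      refine le_trans ?_ ih
      have h1 : J (blockSup V n (j + 1)) + m ≤ J (blockSup V n j) + ε (n + j + 1) + m := by
        rw [add_comm, add_assoc, add_comm (ε _)]
        calc m + J (blockSup V n (j + 1))
            ≤ J (blockSup V n j ⊓ V (n + j + 1)) + J (blockSup V n j ⊔ V (n + j + 1)) :=
              add_le_add_left (iInf_le J _) _
          _ ≤ J (blockSup V n j) + J (V (n + j + 1)) := hsub _ _
          _ ≤ _ := add_le_add_right (hV _).le _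
      have h2 := (ENNReal.add_le_add_iff_right hm).1 h1
      calc J (blockSup V n (j + 1)) + ε (n + (j + 1))
          ≤ J (blockSup V n j) + ε (n + j + 1) + ε (n + j + 1) := add_le_add_left h2 _
        _ = J (blockSup V n j) + ε (n + j) := by rw [add_assoc, hε]
  have hblock' : ∀ n j, J (blockSup V n j) ≤ m + (ε n + ε n) := fun n j =>
    le_self_add.trans (hblock n j)
  have hS : ∀ n, ∃ S : G.Strategy P, ∀ᵐ ω ∂P, ∀ᵐ t ∂G.timeMeasure,
      Tendsto (fun j => (blockSup V n j).path ω t) atTop (𝓝 (S.path ω t)) := fun n => by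
    obtain ⟨C, hC, hbound⟩ := hco (m + (ε n + ε n))
      (ENNReal.add_ne_top.2 ⟨hm, ENNReal.add_ne_top.2 ⟨hεtop n, hεtop n⟩⟩)
    exact exists_tendsto_path_of_monotone (monotone_blockSup V n) hC
      fun j => hbound _ (hblock' n j)
  choose S hS using hS
  have hanti : Antitone S := antitone_nat_of_succ_le fun n =>
    ae_tendsto_path_le (hS (n + 1)) fun j =>
      (blockSup_succ_le V n j).trans (le_of_ae_tendsto_path (monotone_blockSup V n) (hS n) (j + 1))
  have hJS : ∀ n, J (S n) ≤ m + (ε n + ε n) := fun n =>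
    (hlsc _ _ (hS n)).trans (liminf_le_of_frequently_le' (Frequently.of_forall (hblock' n)))
  have hεlim : Tendsto ε atTop (𝓝 0) :=
    ENNReal.tendsto_pow_atTop_nhds_zero_of_lt_one (by simp)
  have hlim : Tendsto (fun n => m + (ε n + ε n)) atTop (𝓝 m) := by
    simpa using tendsto_const_nhds.add (hεlim.add hεlim)
  refine ⟨seqInf S, fun W => le_trans ?_ (iInf_le J W)⟩
  calc J (seqInf S) ≤ liminf (fun n => J (S n)) atTop :=
        hlsc _ _ ((tendsto_path_seqInf hanti).mono fun ω h => Eventually.of_forall h)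
    _ ≤ liminf (fun n => m + (ε n + ε n)) atTop :=
        liminf_le_liminf (Eventually.of_forall hJS)
    _ = m := hlim.liminf_eq

end Strategy

/-! ### Infima of profiles and the greatest subsolution. -/

/-- A bounded, strictly increasing functional of strategy profiles. -/
noncomputable def arctanEnergy (A : Fin N → G.Strategy P) : ENNReal :=
  ∫⁻ ω, ∫⁻ t, ENNReal.ofReal (∑ p : Fin N × Fin d, Real.arctan ((A p.1).path ω t p.2))
    ∂G.timeMeasure ∂P

theorem measurable_sum_arctan (A : Fin N → G.Strategy P) : Measurable fun p : Ω × ℝ =>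
    ENNReal.ofReal (∑ q : Fin N × Fin d, Real.arctan ((A q.1).path p.1 p.2 q.2)) :=
  (Finset.measurable_sum _ fun q _ => Real.measurable_arctan.comp
    (measurable_pi_iff.1 (A q.1).measurable_path q.2)).ennreal_ofReal

theorem exists_forall_arctanEnergy_le [IsFiniteMeasure P] :
    ∃ C ≠ ⊤, ∀ A : Fin N → G.Strategy P, arctanEnergy A ≤ C := by
  refine ⟨∫⁻ _, ∫⁻ _, ENNReal.ofReal (∑ _ : Fin N × Fin d, Real.pi / 2) ∂G.timeMeasure ∂P, ?_,
    fun A => lintegral_mono fun ω => lintegral_mono fun t => ENNReal.ofReal_le_ofReal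
      (Finset.sum_le_sum fun p _ => (Real.arctan_lt_pi_div_two _).le)⟩
  simp only [lintegral_const]
  finiteness

theorem arctanEnergy_lt_top [IsFiniteMeasure P] (A : Fin N → G.Strategy P) :
    arctanEnergy A < ⊤ := by
  obtain ⟨C, hC, h⟩ := exists_forall_arctanEnergy_le (N := N) (G := G) (P := P)
  exact (h A).trans_lt hC.lt_top

theorem arctanEnergy_mono {A B : Fin N → G.Strategy P} (h : A ≤ B) :
    arctanEnergy A ≤ arctanEnergy B := by
  refine lintegral_mono_ae ?_
  filter_upwards [ae_all_iff.2 fun j => Strategy.ae_path_le (h j)] with ω hω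
  exact lintegral_mono fun t => ENNReal.ofReal_le_ofReal
    (Finset.sum_le_sum fun p _ => Real.arctan_mono (hω p.1 t p.2))

/-- Equal finite integrals of ordered integrands agree almost everywhere; ordered sums that agree do
so termwise, and `arctan` is injective. -/
theorem le_of_arctanEnergy_le [IsFiniteMeasure P] {A B : Fin N → G.Strategy P} (h : A ≤ B)
    (hBA : arctanEnergy B ≤ arctanEnergy A) : B ≤ A := by
  have hmono : ∀ᵐ ω ∂P, ∀ t, ∀ p : Fin N × Fin d,
      Real.arctan ((A p.1).path ω t p.2) ≤ Real.arctan ((B p.1).path ω t p.2) := by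
    filter_upwards [ae_all_iff.2 fun j => Strategy.ae_path_le (h j)] with ω hω t p
    exact Real.arctan_mono (hω p.1 t p.2)
  have hle : ∀ᵐ ω ∂P, ∀ t,
      ENNReal.ofReal (∑ p : Fin N × Fin d, Real.arctan ((A p.1).path ω t p.2)) ≤
        ENNReal.ofReal (∑ p : Fin N × Fin d, Real.arctan ((B p.1).path ω t p.2)) := by
    filter_upwards [hmono] with ω hω t
    exact ENNReal.ofReal_le_ofReal (Finset.sum_le_sum fun p _ => hω t p)
  have heq := ae_eq_of_ae_le_of_lintegral_le (hle.mono fun ω hω => lintegral_mono hω)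
    (arctanEnergy_lt_top A).ne (measurable_sum_arctan B).lintegral_prod_right'.aemeasurable hBA
  have hfin := ae_lt_top (measurable_sum_arctan A).lintegral_prod_right' (arctanEnergy_lt_top A).ne
  refine fun j => Strategy.le_of_ae_path_le ?_
  filter_upwards [hmono, hle, heq, hfin] with ω hω hωle hωeq hωfin
  have hω' := ae_eq_of_ae_le_of_lintegral_le (Eventually.of_forall hωle) hωfin.ne
    ((measurable_sum_arctan B).comp measurable_prodMk_left).aemeasurable hωeq.ge
  have hnonneg : ∀ (C : Fin N → G.Strategy P) t,
      0 ≤ ∑ p : Fin N × Fin d, Real.arctan ((C p.1).path ω t p.2) := fun C t =>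
    Finset.sum_nonneg fun p _ => Real.arctan_nonneg.2 ((C p.1).path_nonneg ω t p.2)
  filter_upwards [hω'] with t ht l
  rw [ENNReal.ofReal_eq_ofReal_iff (hnonneg A t) (hnonneg B t),
    Finset.sum_eq_sum_iff_of_le fun p _ => hω t p] at ht
  exact (Real.arctan_injective (ht (j, l) (Finset.mem_univ _))).ge

theorem isGLB_range_seqInf (u : ℕ → Fin N → G.Strategy P) :
    IsGLB (range u) fun j => Strategy.seqInf fun n => u n j := by
  refine ⟨?_, fun A hA j => Strategy.le_seqInf fun n => hA ⟨n, rfl⟩ j⟩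
  rintro _ ⟨n, rfl⟩ j
  exact Strategy.seqInf_le (fun n => u n j) n

theorem exists_isGLB_profile [IsFiniteMeasure P] {D : Set (Fin N → G.Strategy P)}
    (hD : D.Nonempty) : ∃ A, IsGLB D A :=
  exists_isGLB_of_monotone_functional (fun A => (arctanEnergy A).toReal)
    (fun _ B h => ENNReal.toReal_mono (arctanEnergy_lt_top B).ne (arctanEnergy_mono h))
    ⟨0, by rintro _ ⟨A, rfl⟩; exact ENNReal.toReal_nonneg⟩
    (fun A B h h' => le_of_arctanEnergy_le h ((ENNReal.toReal_le_toReal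
      (arctanEnergy_lt_top B).ne (arctanEnergy_lt_top A).ne).1 h'))
    (fun u => ⟨_, isGLB_range_seqInf u⟩) hD

/-- A monotone map of strategy profiles whose values have bounded expected terminal norm has a
greatest subsolution `A ≤ R A`. -/
theorem exists_isGreatest_le_apply [IsFiniteMeasure P]
    {R : (Fin N → G.Strategy P) → Fin N → G.Strategy P} (hR : Monotone R) {C : ENNReal}
    (hC : C ≠ ⊤) (hRC : ∀ A j, (R A j).expectedTerminalNorm ≤ C) :
    ∃ Z, IsGreatest {A | A ≤ R A} Z := by
  obtain ⟨Z, hZ, hmax⟩ := exists_maximal_of_monotone_functional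
    (fun A : Fin N → G.Strategy P => (arctanEnergy A).toReal)
    (fun _ B h => ENNReal.toReal_mono (arctanEnergy_lt_top B).ne (arctanEnergy_mono h))
    (by
      obtain ⟨C, hC, h⟩ := exists_forall_arctanEnergy_le (G := G) (P := P)
      exact ⟨C.toReal, by rintro _ ⟨A, rfl⟩; exact ENNReal.toReal_mono hC (h A)⟩)
    (fun A B h h' => le_of_arctanEnergy_le h ((ENNReal.toReal_le_toReal
      (arctanEnergy_lt_top B).ne (arctanEnergy_lt_top A).ne).1 h'))
    (S := {A | A ≤ R A}) ⟨fun _ => 0, fun j => Strategy.zero_le _⟩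
    (by
      intro u hu huS
      have hu' : ∀ j, Monotone fun n => u n j := fun j m n h => hu h j
      -- The bound `u n ≤ R (u n)` carries the uniform norm bound to the sequence; its limit is
      -- again a subsolution by monotonicity of `R`.
      choose B hB using fun j => Strategy.exists_tendsto_path_of_monotone (hu' j) hC
        fun n => (Strategy.expectedTerminalNorm_mono (huS n j)).trans (hRC (u n) j)
      have huB : ∀ n, u n ≤ B := fun n j => Strategy.le_of_ae_tendsto_path (hu' j) (hB j) n
      exact ⟨B, fun j => Strategy.ae_tendsto_path_le (hB j) fun n =>
        (huS n j).trans (hR (huB n) j), huB⟩)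
  refine ⟨Z, hZ, fun A hA => ?_⟩
  have hAZ : A ≤ fun j => A j ⊔ Z j := fun j => Strategy.le_max_left _ _
  have hZA : Z ≤ fun j => A j ⊔ Z j := fun j => Strategy.le_max_right _ _
  have hmem : (fun j => A j ⊔ Z j) ≤ R fun j => A j ⊔ Z j := fun j =>
    Strategy.max_le ((hA j).trans (hR hAZ j)) ((hZ j).trans (hR hZA j))
  exact hAZ.trans (hmax hmem hZA)

/-! ### Best replies and equilibria. -/

theorem expectedTerminalNorm_le_of_cost_le {K κ : ℝ} (hκ : 0 < κ) {i : Fin N}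
    {A : Fin N → G.Strategy P} (coercive : ENNReal.ofReal K ≤ (A i).expectedTerminalNorm →
      ENNReal.ofReal κ * (A i).expectedTerminalNorm ≤ cost i A)
    {C : ENNReal} (hAC : cost i A ≤ C) :
    (A i).expectedTerminalNorm ≤ max (ENNReal.ofReal K) (C / ENNReal.ofReal κ) := by
  rcases le_total (ENNReal.ofReal K) (A i).expectedTerminalNorm with h | h
  · refine le_max_of_le_right ?_
    rw [ENNReal.le_div_iff_mul_le (by simp [hκ]) (by simp), mul_comm]
    exact (coercive h).trans hAC
  · exact le_max_of_le_left h

theorem max_ofReal_div_ne_top {K κ : ℝ} (hκ : 0 < κ) {C : ENNReal} (hC : C ≠ ⊤) :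
    max (ENNReal.ofReal K) (C / ENNReal.ofReal κ) ≠ ⊤ := by
  rw [ne_eq, max_eq_top, not_or]
  exact ⟨ENNReal.ofReal_ne_top, ENNReal.div_ne_top hC (by simp [hκ])⟩

theorem exists_bestReply (hh : ∀ i, IsSubmodularCost i (G.h i))
    (hg : ∀ i, IsSubmodularCost i (G.g i)) {K κ : ℝ} (hκ : 0 < κ) {i : Fin N}
    (coercive : ∀ A : Fin N → G.Strategy P, ENNReal.ofReal K ≤ (A i).expectedTerminalNorm →
      ENNReal.ofReal κ * (A i).expectedTerminalNorm ≤ cost i A)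
    {A : Fin N → G.Strategy P} (hfin : ∃ V, cost i (Function.update A i V) ≠ ⊤) :
    ∃ V, ∀ W, cost i (Function.update A i V) ≤ cost i (Function.update A i W) := by
  refine Strategy.exists_forall_le_of_submodular (fun V => cost i (Function.update A i V))
    (cost_inf_add_cost_sup_le hh hg le_rfl i)
    (fun V S h => cost_update_le_liminf hh hg A i h) hfin fun C hC => ?_
  refine ⟨_, max_ofReal_div_ne_top (K := K) hκ hC, fun V hV => ?_⟩
  simpa only [Function.update_self] using
    expectedTerminalNorm_le_of_cost_le hκ (coercive (Function.update A i V)) hV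

/-- Minimizers of the cost of a player are unique up to indistinguishability. -/
theorem le_of_forall_cost_le (hh : ∀ i, IsSubmodularCost i (G.h i))
    (hg : ∀ i, IsSubmodularCost i (G.g i)) {A : Fin N → G.Strategy P} {i : Fin N}
    {V W : G.Strategy P} (hfin : cost i (Function.update A i W) ≠ ⊤)
    (hV : ∀ U, cost i (Function.update A i V) ≤ cost i (Function.update A i U))
    (hW : ∀ U, cost i (Function.update A i W) ≤ cost i (Function.update A i U)) : V ≤ W := by
  refine le_of_cost_add_cost_le_average hh hg A i
    (ENNReal.add_ne_top.2 ⟨ne_top_of_le_ne_top hfin (hV W), hfin⟩) ?_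
  rw [two_mul]
  exact add_le_add (hV _) (hW _)

/-- Best replies are nondecreasing in the strategies of the opponents. -/
theorem bestReply_mono (hh : ∀ i, IsSubmodularCost i (G.h i))
    (hg : ∀ i, IsSubmodularCost i (G.g i)) {A B : Fin N → G.Strategy P} (hAB : A ≤ B) {i : Fin N}
    {V W : G.Strategy P} (hVfin : cost i (Function.update A i V) ≠ ⊤)
    (hWfin : cost i (Function.update B i W) ≠ ⊤)
    (hV : ∀ U, cost i (Function.update A i V) ≤ cost i (Function.update A i U))
    (hW : ∀ U, cost i (Function.update B i W) ≤ cost i (Function.update B i U)) : V ≤ W := by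
  have h := cost_inf_add_cost_sup_le hh hg hAB i V W
  -- Optimality of `W` against `B` cancels the join, so `V ⊓ W` is also optimal against `A`, and
  -- uniqueness identifies it with `V`.
  have h' : cost i (Function.update A i (V ⊓ W)) ≤ cost i (Function.update A i V) :=
    (ENNReal.add_le_add_iff_right hWfin).1 ((add_le_add_right (hW _) _).trans h)
  have hle : V ≤ V ⊓ W := le_of_forall_cost_le hh hg (ne_top_of_le_ne_top hVfin h') hV
    fun U => h'.trans (hV U)
  exact hle.trans (Eventually.of_forall fun ω t => inf_le_right)

end

end MonotoneFollowerGame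

theorem theorem2p1 {Ω : Type*} [MeasurableSpace Ω] (P : Measure Ω) [IsProbabilityMeasure P]
    [P.IsComplete] {N k d : ℕ} (hN : 2 ≤ N) (G : MonotoneFollowerGame Ω N k d)
    (hh : ∀ i, IsSubmodularCost i (G.h i)) (hg : ∀ i, IsSubmodularCost i (G.g i))
    (K κ : ℝ) (hK : 0 < K) (hκ : 0 < κ)
    (coercive : ∀ (i : Fin N) (A : Fin N → G.Strategy P),
      ENNReal.ofReal K ≤ (A i).expectedTerminalNorm →
        ENNReal.ofReal κ * (A i).expectedTerminalNorm ≤ MonotoneFollowerGame.cost i A)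
    (M : ℝ) (hM : 0 < M)
    (bounded : ∀ (i : Fin N) (A : Fin N → G.Strategy P), ∃ r : G.Strategy P,
      MonotoneFollowerGame.cost i (Function.update A i r) ≤ ENNReal.ofReal M) :
    (G.nashEquilibria P).Nonempty ∧
      -- the poset of Nash equilibria up to indistinguishability is a complete lattice
      ∀ S : Set (Antisymmetrization (G.nashEquilibria P) (· ≤ ·)),
        (∃ B, IsLUB S B) ∧ ∃ B, IsGLB S B := by
  have hbest : ∀ (A : Fin N → G.Strategy P) (i : Fin N), ∃ V : G.Strategy P, ∀ W,
      MonotoneFollowerGame.cost i (Function.update A i V) ≤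
        MonotoneFollowerGame.cost i (Function.update A i W) := fun A i => by
    obtain ⟨r, hr⟩ := bounded i A
    exact MonotoneFollowerGame.exists_bestReply hh hg hκ (coercive i)
      ⟨r, ne_top_of_le_ne_top ENNReal.ofReal_ne_top hr⟩
  choose R hR using hbest
  have hRM : ∀ A i, MonotoneFollowerGame.cost i (Function.update A i (R A i)) ≤
      ENNReal.ofReal M := fun A i => by
    obtain ⟨r, hr⟩ := bounded i A
    exact (hR A i r).trans hr
  have hRfin : ∀ A i, MonotoneFollowerGame.cost i (Function.update A i (R A i)) ≠ ⊤ :=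
    fun A i => ne_top_of_le_ne_top ENNReal.ofReal_ne_top (hRM A i)
  have hmono : Monotone R := fun A B hAB i =>
    MonotoneFollowerGame.bestReply_mono hh hg hAB (hRfin A i) (hRfin B i) (hR A i) (hR B i)
  obtain ⟨Z, hZ⟩ := MonotoneFollowerGame.exists_isGreatest_le_apply hmono
    (MonotoneFollowerGame.max_ofReal_div_ne_top (K := K) hκ (ENNReal.ofReal_ne_top (r := M)))
    fun A i => by
      simpa only [Function.update_self] using
        MonotoneFollowerGame.expectedTerminalNorm_le_of_cost_le hκ
          (coercive i (Function.update A i (R A i))) (hRM A i)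
  -- An equilibrium strategy and the chosen best reply minimize the same cost, hence are
  -- indistinguishable. Conversely, the cost is unchanged when `A i` is replaced by an
  -- indistinguishable `R A i`.
  refine fixedPoints_complete hmono
    (fun D hD => MonotoneFollowerGame.exists_isGLB_profile hD) hZ fun A => ⟨fun hA => ?_, ?_⟩
  · have hmin : ∀ i W, MonotoneFollowerGame.cost i (Function.update A i (A i)) ≤
        MonotoneFollowerGame.cost i (Function.update A i W) := fun i W => by
      rw [Function.update_eq_self]
      exact (hA i).2 W
    have hfin : ∀ i, MonotoneFollowerGame.cost i (Function.update A i (A i)) ≠ ⊤ := fun i => by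
      rw [Function.update_eq_self]
      exact (hA i).1.ne
    exact ⟨fun i => MonotoneFollowerGame.le_of_forall_cost_le hh hg (hRfin A i) (hmin i) (hR A i),
      fun i => MonotoneFollowerGame.le_of_forall_cost_le hh hg (hfin i) (hR A i) (hmin i)⟩
  · rintro ⟨hAR, hRA⟩ i
    have hcost : MonotoneFollowerGame.cost i A =
        MonotoneFollowerGame.cost i (Function.update A i (R A i)) := by
      conv_lhs => rw [← Function.update_eq_self i A]
      exact MonotoneFollowerGame.cost_congr
        (MonotoneFollowerGame.update_le_update_of_le le_rfl i (hAR i))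
        (MonotoneFollowerGame.update_le_update_of_le le_rfl i (hRA i)) i
    exact ⟨hcost ▸ (hRfin A i).lt_top, fun V => hcost ▸ hR A i V⟩
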